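/- Let $q\in\mathbb C$ with $0<|q|<1$ and fix a square root $q^{1/2}$ of $q$. For a meromorphic function $f$ in $\mathbb C$ write $\breve f(z)=f\big((z+1/z)/2\big)$. The Askey–Wilson operator is defined for $x=(z+1/z)/2\neq\pm1$ by $$(\mathcal D_qf)(x)=\frac{\breve f(q^{1/2}z)-\breve f(q^{-1/2}z)}{(q^{1/2}-q^{-1/2})(z-1/z)/2},$$ and at $x=\pm1$ by taking the limit; $\mathcal D_q^0f=f$ and $\mathcal D_q^{j}f=\mathcal D_q(\mathcal D_q^{j-1}f)$. Let $\varphi:(R_0,\infty)\to(0,\infty)$ be non-decreasing and unbounded with $\log r\le\varphi(r)\le r$ for all large $r$, and subadditive, that is, $\varphi(a+b)\le\varphi(a)+\varphi(b)$ for all sufficiently large $a,b$. Let $s:(R_0,\infty)\to(0,\infty)$ be non-decreasing with $r<s(r)\le r^2$ for all large $r$ and $\liminf_{r\to\infty}s(r)/r>1$. Put $$\alpha_{\varphi,s}=\liminf_{r\to\infty}\frac{\log\varphi(r)}{\log\varphi(s(r))}\in[0,1],\qquad \rho_\varphi(f)=\limsup_{r\to\infty}\frac{\log T(r,f)}{\log\varphi(r)}\in[-\infty,\infty],$$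 where $T(r,f)$ is the Nevanlinna characteristic of the meromorphic function $f$ and $\log 0=-\infty$. **Theorem.** Let $n\ge1$ and let $a_0,\ldots,a_{n+1}$ be meromorphic functions in $\mathbb C$ with $a_0a_n\not\equiv0$, such that $\rho_\varphi(a_j)<\infty$ for $0\le j\le n$ and $$\rho_\varphi(a_0)>\max_{1\le j\le n+1}\rho_\varphi(a_j).$$ If $f$ is a non-constant meromorphic function in $\mathbb C$ satisfying $$\sum_{j=0}^n a_j(x)\,\mathcal D_q^jf(x)=a_{n+1}(x),$$ then $\rho_\varphi(f)\ge\alpha_{\varphi,s}^{\,n-1}\rho_\varphi(a_0)$, where $\alpha_{\varphi,s}^{0}=1$. -/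

import Mathlib

open Filter Topology

noncomputable section

namespace AskeyWilson

/-- The Joukowski map `z ↦ x = (z + 1/z)/2`. -/
def joukowski (z : ℂ) : ℂ := (z + z⁻¹) / 2

/-- `f̆(z) = f((z + 1/z)/2)`. -/
def breve (f : ℂ → ℂ) (z : ℂ) : ℂ := f (joukowski z)

/-- A choice of `z ≠ 0` with `x = (z + 1/z)/2`, namely `z = x + √(x² - 1)`. The Askey-Wilson
quotient below is invariant under `z ↦ 1/z`, so the branch of the root is immaterial. -/
def branch (x : ℂ) : ℂ := x + (x ^ 2 - 1) ^ (1 / 2 : ℂ)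

/-- `(f̆(q^{1/2} z) - f̆(q^{-1/2} z)) / (ĕ(q^{1/2} z) - ĕ(q^{-1/2} z))` with `e(x) = x`,
where `p` stands for `q^{1/2}`. -/
def quotient (p : ℂ) (f : ℂ → ℂ) (z : ℂ) : ℂ :=
  (breve f (p * z) - breve f (p⁻¹ * z)) / (breve id (p * z) - breve id (p⁻¹ * z))

open scoped Classical in
/-- The Askey-Wilson operator `𝒟_q` (with `p = q^{1/2}`): the divided difference for `x ≠ ±1`,
extended to `x = ±1` by its limit. Applied to a meromorphic function, the values at the isolated
points where a pole is involved carry no meaning; all identities between meromorphic functions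
are therefore read off a closed discrete set. -/
def awOp (p : ℂ) (f : ℂ → ℂ) (x : ℂ) : ℂ :=
  if x = 1 ∨ x = -1 then limUnder (𝓝[≠] x) (fun y => quotient p f (branch y))
  else quotient p f (branch x)

/-- Equality of meromorphic functions on `ℂ`: equality off a closed discrete set. -/
def MerEq (f g : ℂ → ℂ) : Prop := f =ᶠ[codiscrete ℂ] g

/-- Standing assumptions on the comparison function `φ : (R₀, ∞) → (0, ∞)`: it is non-decreasing
and unbounded, and `log r ≤ φ(r) ≤ r` for all large `r`. -/
structure IsGrowthFunction (R₀ : ℝ) (φ : ℝ → ℝ) : Prop where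
  pos : ∀ r, R₀ < r → 0 < φ r
  mono : MonotoneOn φ (Set.Ioi R₀)
  unbounded : ¬ BddAbove (φ '' Set.Ioi R₀)
  log_le : ∀ᶠ r in atTop, Real.log r ≤ φ r
  le_self : ∀ᶠ r in atTop, φ r ≤ r

/-- Subadditivity for all large arguments. -/
def IsSubadditive (φ : ℝ → ℝ) : Prop :=
  ∃ R₁ : ℝ, ∀ a b : ℝ, R₁ ≤ a → R₁ ≤ b → φ (a + b) ≤ φ a + φ b

/-- Standing assumptions on `s : (R₀, ∞) → (0, ∞)`: it is non-decreasing, `r < s(r) ≤ r²` for all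
large `r`, and `liminf s(r)/r > 1`. -/
structure IsScaleFunction (R₀ : ℝ) (s : ℝ → ℝ) : Prop where
  pos : ∀ r, R₀ < r → 0 < s r
  mono : MonotoneOn s (Set.Ioi R₀)
  lt_self : ∀ᶠ r in atTop, r < s r
  le_sq : ∀ᶠ r in atTop, s r ≤ r ^ 2
  one_lt_liminf : 1 < liminf (fun r : ℝ => ((s r / r : ℝ) : EReal)) atTop

/-- The `φ`-order `ρ_φ(f) = limsup_{r → ∞} log T(r, f) / log φ(r)` in `[-∞, ∞]`, where `T(r, f)` is
the Nevanlinna characteristic and `log 0 = -∞`. -/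
def phiOrder (φ : ℝ → ℝ) (f : ℂ → ℂ) : EReal :=
  limsup (fun r : ℝ =>
    ENNReal.log (ENNReal.ofReal (ValueDistribution.characteristic f ⊤ r)) /
      ((Real.log (φ r) : ℝ) : EReal)) atTop

/-- `α_{φ,s} = liminf_{r → ∞} log φ(r) / log φ(s(r))`. -/
def alpha (φ s : ℝ → ℝ) : EReal :=
  liminf (fun r : ℝ => ((Real.log (φ r) / Real.log (φ (s r)) : ℝ) : EReal)) atTop

end AskeyWilson

end

/-! ### Poisson domination: pointwise bounds for holomorphic functions. -/

noncomputable section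
namespace AskeyWilson

open Real Metric MeromorphicOn

/-! The stronger inequality `ρ_φ(f) ≥ ρ_φ(a₀)` holds whenever `ρ_φ(a₀) > 0`. Since `0 ≤ α ≤ 1`, it
implies the claim; the scale `s` enters only through these bounds on `α`. If `ρ_φ(a₀) ≤ 0`, the left
side is at most `0`, while a non-constant `f` has `ρ_φ(f) ≥ 0`.

The analytic core is `exists_characteristic_awOp_le`: `T(r, 𝒟_q f) ≤ C T(Kr, f) + C`, with `C` and
`K` independent of `r`. For `|x| ≤ r` the two nodes `w₁, w₂` lie in a disk of radius `R` comparable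
to `r`. On a larger disk write `f = g/h`, where `h` is the monic polynomial of the poles and `g` is
holomorphic, with `log|g|` controlled by the proximity function of `f` through the Poisson kernel.
Then `𝒟_q f · h(w₁)h(w₂)` is an antisymmetric expression in the nodes divided by `w₁ - w₂`; it has
no poles and is bounded on `|x| = r`. The product `h(w₁)h(w₂)` is symmetric in the nodes, hence a
polynomial in `x`. Jensen's formula expresses the characteristic of its normalised reciprocal by a
Mahler measure, and a lower bound for that measure, factor by factor, turns the cost into a multiple
of the counting function of `f`.

Solving the equation for `a₀` and dividing by `f` bounds `T(r, a₀)` by the characteristics of the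
other coefficients and a multiple of `T(Kr, f)` (`exists_characteristic_coeff_zero_le`).
Subadditivity gives `φ(Kr) ≤ M φ(r)`, so the dilation by `K` costs nothing in the `φ`-order, and a
smaller order of `f` would contradict the dominance of `a₀`. -/

/-- The Poisson integral over the circle of radius `R` dominates `log ‖g‖`. -/
def PoissonDominated (R : ℝ) (g : ℂ → ℂ) : Prop :=
  (∀ z ∈ closedBall (0 : ℂ) R, AnalyticAt ℂ g z ∧ meromorphicOrderAt g z ≠ ⊤) ∧
    ∀ w ∈ ball (0 : ℂ) R, g w ≠ 0 →
      log ‖g w‖ ≤ circleAverage ((Complex.re ∘ herglotzRieszKernel 0 w) • (log ‖g ·‖)) 0 R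

lemma circleIntegrable_poisson_smul {R : ℝ} {w : ℂ} (hw : w ∈ ball (0 : ℂ) R)
    {u : ℂ → ℝ} (hu : CircleIntegrable u 0 R) :
    CircleIntegrable ((Complex.re ∘ herglotzRieszKernel 0 w) • u) 0 R := by
  refine hu.continuousOn_smul ?_
  exact Complex.continuous_re.comp_continuousOn (continuousOn_herglotzRieszKernel_sphere hw)

lemma PoissonDominated.circleIntegrable {R : ℝ} (hR : 0 < R) {g : ℂ → ℂ}
    (hg : PoissonDominated R g) : CircleIntegrable (log ‖g ·‖) 0 R := by
  apply MeromorphicOn.circleIntegrable_log_norm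
  intro z hz
  rw [abs_of_pos hR] at hz
  exact (hg.1 z (sphere_subset_closedBall hz)).1.meromorphicAt

/-- Off the discrete zero set `log‖gh‖ = log‖g‖ + log‖h‖`, and circle averages ignore discrete sets.
-/
lemma PoissonDominated.mul {R : ℝ} (hR : 0 < R) {g h : ℂ → ℂ} (hg : PoissonDominated R g)
    (hh : PoissonDominated R h) : PoissonDominated R (g * h) := by
  refine ⟨fun z hz => ⟨(hg.1 z hz).1.mul (hh.1 z hz).1, ?_⟩, ?_⟩
  · rw [meromorphicOrderAt_mul (hg.1 z hz).1.meromorphicAt (hh.1 z hz).1.meromorphicAt]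
    exact WithTop.add_ne_top.2 ⟨(hg.1 z hz).2, (hh.1 z hz).2⟩
  · intro w hw hgh
    have hgw : g w ≠ 0 := fun h0 => hgh (by simp [h0])
    have hhw : h w ≠ 0 := fun h0 => hgh (by simp [h0])
    have e : circleAverage ((Complex.re ∘ herglotzRieszKernel 0 w) • (log ‖(g * h) ·‖)) 0 R
        = circleAverage ((Complex.re ∘ herglotzRieszKernel 0 w) • (log ‖g ·‖)
          + (Complex.re ∘ herglotzRieszKernel 0 w) • (log ‖h ·‖)) 0 R := by
      apply circleAverage_congr_codiscreteWithin _ hR.ne'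
      have h1 : ∀ᶠ x in codiscreteWithin (sphere (0 : ℂ) |R|), g x ≠ 0 := by
        refine MeromorphicOn.eventually_codiscreteWithin_apply_ne_zero (fun z hz => ?_)
          (fun z hz => ?_) <;> rw [abs_of_pos hR] at hz
        exacts [(hg.1 z (sphere_subset_closedBall hz)).1.meromorphicAt,
          (hg.1 z (sphere_subset_closedBall hz)).2]
      have h2 : ∀ᶠ x in codiscreteWithin (sphere (0 : ℂ) |R|), h x ≠ 0 := by
        refine MeromorphicOn.eventually_codiscreteWithin_apply_ne_zero (fun z hz => ?_)
          (fun z hz => ?_) <;> rw [abs_of_pos hR] at hz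
        exacts [(hh.1 z (sphere_subset_closedBall hz)).1.meromorphicAt,
          (hh.1 z (sphere_subset_closedBall hz)).2]
      filter_upwards [h1, h2] with x hx1 hx2
      simp only [Pi.smul_apply', Pi.add_apply, Pi.mul_apply, smul_eq_mul, norm_mul]
      rw [log_mul (norm_ne_zero_iff.2 hx1) (norm_ne_zero_iff.2 hx2)]
      ring
    rw [e, circleAverage_add (circleIntegrable_poisson_smul hw (hg.circleIntegrable hR))
      (circleIntegrable_poisson_smul hw (hh.circleIntegrable hR))]
    simp only [Pi.mul_apply, norm_mul]
    rw [log_mul (norm_ne_zero_iff.2 hgw) (norm_ne_zero_iff.2 hhw)]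
    exact add_le_add (hg.2 w hw hgw) (hh.2 w hw hhw)

/-- Without zeros `log‖g‖` is harmonic, so Poisson's formula holds with equality. -/
lemma poissonDominated_of_ne_zero {R : ℝ} {g : ℂ → ℂ}
    (hg : AnalyticOnNhd ℂ g (closedBall 0 R)) (h0 : ∀ z ∈ closedBall (0 : ℂ) R, g z ≠ 0) :
    PoissonDominated R g := by
  refine ⟨fun z hz => ⟨hg z hz, ?_⟩, fun w hw _ => ?_⟩
  · rw [(hg z hz).meromorphicNFAt.meromorphicOrderAt_eq_zero_iff.2 (h0 z hz)]
    exact WithTop.zero_ne_top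
  · rw [InnerProductSpace.HarmonicOnNhd.circleAverage_re_herglotzRieszKernel_smul
      (f := fun x => log ‖g x‖) (fun z hz => (hg z hz).harmonicAt_log_norm (h0 z hz)) hw]

/-- For `u` inside the disk, `z - u` is compared with the zero-free function `R - ū z / R`, which
has the same modulus on the circle and a larger one inside. For `u` on the circle the Poisson
formula itself still holds. -/
lemma poissonDominated_sub_const {R : ℝ} (hR : 0 < R) {u : ℂ} (hu : u ∈ closedBall (0 : ℂ) R) :
    PoissonDominated R (fun z => z - u) := by
  refine ⟨fun z _ => ⟨by fun_prop, ?_⟩, fun w hw hwu => ?_⟩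
  · rw [meromorphicOrderAt_ne_top_iff_eventually_ne_zero (by fun_prop)]
    by_cases h : z = u
    · filter_upwards [self_mem_nhdsWithin] with x hx
      rw [h] at hx
      exact sub_ne_zero.2 hx
    · exact ((continuous_id.sub continuous_const).continuousAt.eventually_ne
        (sub_ne_zero.2 h)).filter_mono nhdsWithin_le_nhds
  · rcases (mem_closedBall_zero_iff.1 hu).lt_or_eq with hlt | heq
    · have hk0 : ∀ z ∈ closedBall (0 : ℂ) R, (R : ℂ) - starRingEnd ℂ u * z / R ≠ 0 := by
        intro z hz h
        have h1 : ‖starRingEnd ℂ u * z / R‖ = R := by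
          rw [← sub_eq_zero.1 h, Complex.norm_real, norm_eq_abs, abs_of_pos hR]
        rw [norm_div, norm_mul, RCLike.norm_conj, Complex.norm_real, norm_eq_abs, abs_of_pos hR,
          div_eq_iff hR.ne'] at h1
        nlinarith [mem_closedBall_zero_iff.1 hz, norm_nonneg z, norm_nonneg u]
      have hk := (poissonDominated_of_ne_zero (R := R)
        (g := fun z => (R : ℂ) - starRingEnd ℂ u * z / R)
        (fun z _ => by fun_prop) hk0).2 w hw (hk0 w (ball_subset_closedBall hw))
      have key : ∀ z : ℂ, ‖(R : ℂ) - starRingEnd ℂ u * z / R‖ ^ 2 - ‖z - u‖ ^ 2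
          = (R ^ 2 - ‖z‖ ^ 2) * (R ^ 2 - ‖u‖ ^ 2) / R ^ 2 := by
        intro z
        have hc : (R : ℂ) - starRingEnd ℂ u * z / R
            = ((R : ℝ) : ℂ) - starRingEnd ℂ u * z * ((R⁻¹ : ℝ) : ℂ) := by
          push_cast; ring
        rw [hc, ← Complex.normSq_eq_norm_sq, ← Complex.normSq_eq_norm_sq,
          ← Complex.normSq_eq_norm_sq, ← Complex.normSq_eq_norm_sq]
        simp only [Complex.normSq_apply, Complex.sub_re, Complex.sub_im, Complex.mul_re,
          Complex.mul_im, Complex.conj_re, Complex.conj_im, Complex.ofReal_re, Complex.ofReal_im]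
        field_simp
        ring
      have e : circleAverage ((Complex.re ∘ herglotzRieszKernel 0 w) • (log ‖· - u‖)) 0 R
          = circleAverage ((Complex.re ∘ herglotzRieszKernel 0 w) •
            (fun z => log ‖(R : ℂ) - starRingEnd ℂ u * z / R‖)) 0 R := by
        apply circleAverage_congr_sphere
        intro z hz
        rw [abs_of_pos hR, mem_sphere_zero_iff_norm] at hz
        have h1 := key z
        rw [hz, sub_self, zero_mul, zero_div, sub_eq_zero] at h1
        have h2 := (sq_eq_sq₀ (norm_nonneg _) (norm_nonneg _)).1 h1
        simp only [Pi.smul_apply', h2]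
      rw [e]
      refine le_trans (log_le_log (norm_pos_iff.2 hwu) ?_) hk
      have h1 := key w
      have hwR := mem_ball_zero_iff.1 hw
      have h2 : 0 ≤ (R ^ 2 - ‖w‖ ^ 2) * (R ^ 2 - ‖u‖ ^ 2) / R ^ 2 := by
        have := norm_nonneg w
        have := norm_nonneg u
        have : 0 ≤ R ^ 2 - ‖w‖ ^ 2 := by nlinarith
        have : 0 ≤ R ^ 2 - ‖u‖ ^ 2 := by nlinarith
        positivity
      exact (sq_le_sq₀ (norm_nonneg _) (norm_nonneg _)).1 (by linarith)
    · have := circleAverage_re_herglotzRieszKernel_mul_log (c := 0) (R := R)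
        (mem_sphere_zero_iff_norm.2 heq) hw
      exact this.ge

lemma PoissonDominated.pow {R : ℝ} (hR : 0 < R) {g : ℂ → ℂ} (hg : PoissonDominated R g) (n : ℕ) :
    PoissonDominated R (g ^ n) := by
  induction n with
  | zero =>
    rw [pow_zero]
    exact poissonDominated_of_ne_zero (fun z _ => analyticAt_const) (fun z _ => one_ne_zero)
  | succ n ih => rw [pow_succ]; exact ih.mul hR hg

lemma PoissonDominated.prod {R : ℝ} (hR : 0 < R) {ι : Type*} (s : Finset ι) {g : ι → ℂ → ℂ}
    (hg : ∀ i ∈ s, PoissonDominated R (g i)) : PoissonDominated R (∏ i ∈ s, g i) :=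
  Finset.prod_induction g (PoissonDominated R) (fun _ _ ha hb => ha.mul hR hb)
    (poissonDominated_of_ne_zero (fun _ _ => analyticAt_const) (fun _ _ => one_ne_zero)) hg

/-- On the compact disk `g` is a finite product of linear factors times a zero-free function, and
domination is multiplicative. -/
lemma AnalyticOnNhd.poissonDominated {R : ℝ} (hR : 0 < R) {g : ℂ → ℂ}
    (hg : AnalyticOnNhd ℂ g (closedBall 0 R))
    (htop : ∀ z ∈ closedBall (0 : ℂ) R, meromorphicOrderAt g z ≠ ⊤) :
    PoissonDominated R g := by
  have hfin : (divisor g (closedBall 0 R)).support.Finite :=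
    (divisor g (closedBall 0 R)).finiteSupport (isCompact_closedBall 0 R)
  obtain ⟨k, hk, hk0, hgk⟩ := hg.meromorphicOn.extract_zeros_poles (fun u => htop u u.2) hfin
  set D := divisor g (closedBall 0 R)
  have hP : PoissonDominated R ((∏ᶠ u, (fun x => x - u) ^ D u) • k) := by
    refine PoissonDominated.mul hR ?_ (poissonDominated_of_ne_zero hk fun z hz => hk0 ⟨z, hz⟩)
    rw [finprod_eq_prod_of_mulSupport_subset (s := hfin.toFinset)]
    · refine PoissonDominated.prod hR _ fun u hu => ?_
      have hu' : u ∈ closedBall (0 : ℂ) R := D.supportWithinDomain (by simpa using hu)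
      obtain ⟨n, hn⟩ := Int.eq_ofNat_of_zero_le (hg.divisor_nonneg u)
      change D u = n at hn
      rw [hn, zpow_natCast]
      exact (poissonDominated_sub_const hR hu').pow hR n
    · rw [Function.FactorizedRational.mulSupport]
      simp
  refine ⟨fun z hz => ⟨hg z hz, htop z hz⟩, fun w hw hgw => ?_⟩
  have hwc := ball_subset_closedBall hw
  -- The factorisation holds only off a discrete set; continuity of both sides transfers it to the
  -- point `w`.
  have hacc : AccPt w (𝓟 (closedBall (0 : ℂ) R)) :=
    (accPt_iff_frequently_nhdsNE.2 <| Eventually.frequently <|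
      (isOpen_ball.eventually_mem hw).filter_mono nhdsWithin_le_nhds).mono
      (principal_mono.2 ball_subset_closedBall)
  have h1 := (hg w hwc).meromorphicAt.eventuallyEq_nhdsNE_of_eventuallyEq_codiscreteWithin
    (hP.1 w hwc).1.meromorphicAt hwc hacc hgk
  have h2 := (((hg w hwc).continuousAt.eventuallyEq_nhds_iff_eventuallyEq_nhdsNE
    (hP.1 w hwc).1.continuousAt).1 h1).eq_of_nhds
  have h3 := hP.2 w hw (h2 ▸ hgw)
  rw [← h2] at h3
  refine h3.trans_eq (circleAverage_congr_codiscreteWithin ?_ hR.ne')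
  have h4 := hgk.filter_mono (codiscreteWithin_mono
    (sphere_subset_closedBall.trans_eq (by rw [abs_of_pos hR]) : sphere (0 : ℂ) |R| ⊆ _))
  filter_upwards [h4] with x hx
  simp only [Pi.smul_apply', hx]

/-- A holomorphic function is bounded on a disk by its proximity function on the doubled circle. -/
theorem posLog_norm_le_three_mul_circleAverage {R : ℝ} (hR : 0 < R) {g : ℂ → ℂ}
    (hg : AnalyticOnNhd ℂ g (closedBall 0 (2 * R))) {w : ℂ} (hw : ‖w‖ ≤ R) :
    log⁺ ‖g w‖ ≤ 3 * circleAverage (log⁺ ‖g ·‖) 0 (2 * R) := by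
  have hR2 : 0 < 2 * R := by linarith
  have hwb : w ∈ ball (0 : ℂ) (2 * R) := by rw [mem_ball_zero_iff]; linarith
  have hwc := ball_subset_closedBall hwb
  have hnn : 0 ≤ circleAverage (log⁺ ‖g ·‖) 0 (2 * R) :=
    circleAverage_nonneg_of_nonneg fun _ _ => posLog_nonneg
  by_cases h0 : g w = 0
  · simp [h0, hnn]
  have hmer : MeromorphicOn g (sphere 0 |2 * R|) := fun z hz => by
    rw [abs_of_pos hR2] at hz
    exact (hg z (sphere_subset_closedBall hz)).meromorphicAt
  have htop : ∀ z ∈ closedBall (0 : ℂ) (2 * R), meromorphicOrderAt g z ≠ ⊤ := by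
    have := (hg.meromorphicOn.exists_meromorphicOrderAt_ne_top_iff_forall
      ((convex_closedBall (0 : ℂ) (2 * R)).isConnected ⟨w, hwc⟩)).1
      ⟨⟨w, hwc⟩, by
        rw [(hg w hwc).meromorphicNFAt.meromorphicOrderAt_eq_zero_iff.2 h0]
        exact WithTop.zero_ne_top⟩
    exact fun z hz => this ⟨z, hz⟩
  have h1 := (AnalyticOnNhd.poissonDominated hR2 hg htop).2 w hwb h0
  have hint := hmer.circleIntegrable_posLog_norm
  have h2 : circleAverage ((Complex.re ∘ herglotzRieszKernel 0 w) • (log ‖g ·‖)) 0 (2 * R)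
      ≤ circleAverage (fun z => (3 : ℝ) • log⁺ ‖g z‖) 0 (2 * R) := by
    apply circleAverage_mono
      (circleIntegrable_poisson_smul hwb hmer.circleIntegrable_log_norm)
      hint.const_smul
    intro z hz
    rw [abs_of_pos hR2] at hz
    have hle := re_herglotzRieszKernel_le hz hwb
    have hge := le_re_herglotzRieszKernel hz hwb
    simp only [Pi.smul_apply', Function.comp_apply, smul_eq_mul, herglotzRieszKernel_def]
    set P := ((z - 0 + (w - 0)) / (z - 0 - (w - 0))).re
    rw [sub_zero] at hle hge
    have hw0 := norm_nonneg w
    -- Positivity of the kernel allows `log` to be replaced by `log⁺`; the constant is `3 = (2R +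
    -- R)/(2R - R)`.
    have hP0 : 0 ≤ P := le_trans (div_nonneg (by linarith) (by linarith)) hge
    have hP3 : P ≤ 3 := hle.trans (by rw [div_le_iff₀ (by linarith)]; linarith)
    calc P * log ‖g z‖ ≤ P * log⁺ ‖g z‖ := by
          gcongr; exact le_max_right _ _
      _ ≤ 3 * log⁺ ‖g z‖ := by gcongr; exact posLog_nonneg
  rw [circleAverage_fun_smul, smul_eq_mul] at h2
  rw [posLog]
  exact max_le (by positivity) (h1.trans h2)

end AskeyWilson
end

/-! ### The nodes of the divided difference, and meromorphy of its image. -/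

noncomputable section
namespace AskeyWilson

open Polynomial

/-- The multiplier `(p + 1/p)/2` of `x` in `(p z + 1/(p z))/2`. -/
def cosCoeff (p : ℂ) : ℂ := (p + p⁻¹) / 2

/-- The multiplier `(p - 1/p)/2` of `√(x² - 1)` in `(p z + 1/(p z))/2`. -/
def sinCoeff (p : ℂ) : ℂ := (p - p⁻¹) / 2

/-- The principal branch of `√(x² - 1)`. -/
def root (x : ℂ) : ℂ := (x ^ 2 - 1) ^ (1 / 2 : ℂ)

/-- The first node of the divided difference at `x`. -/
def nodePos (p x : ℂ) : ℂ := cosCoeff p * x + sinCoeff p * root x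

/-- The second node of the divided difference at `x`. -/
def nodeNeg (p x : ℂ) : ℂ := cosCoeff p * x - sinCoeff p * root x

lemma root_sq (x : ℂ) : root x ^ 2 = x ^ 2 - 1 := by
  rw [root, ← Complex.cpow_nat_mul]
  norm_num

lemma root_ne_zero {x : ℂ} (h1 : x ≠ 1) (h2 : x ≠ -1) : root x ≠ 0 := by
  intro h
  have := root_sq x
  rw [h] at this
  have h3 : (x - 1) * (x + 1) = 0 := by linear_combination -this
  rcases mul_eq_zero.1 h3 with h | h
  · exact h1 (sub_eq_zero.1 h)
  · exact h2 (eq_neg_of_add_eq_zero_left h)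

lemma norm_root_le (x : ℂ) : ‖root x‖ ≤ ‖x‖ + 1 := by
  have h : ‖root x‖ ^ 2 ≤ (‖x‖ + 1) ^ 2 := by
    rw [← norm_pow, root_sq]
    calc ‖x ^ 2 - 1‖ ≤ ‖x ^ 2‖ + ‖(1 : ℂ)‖ := norm_sub_le _ _
      _ = ‖x‖ ^ 2 + 1 := by rw [norm_pow, norm_one]
      _ ≤ _ := by nlinarith [norm_nonneg x]
  exact (sq_le_sq₀ (norm_nonneg _) (by positivity)).1 h

lemma cosCoeff_sq {p : ℂ} (hp : p ≠ 0) : cosCoeff p ^ 2 = 1 + sinCoeff p ^ 2 := by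
  rw [cosCoeff, sinCoeff]
  field_simp
  ring

lemma sinCoeff_ne_zero {p : ℂ} (hp : p ≠ 0) (hp1 : p ^ 2 ≠ 1) : sinCoeff p ≠ 0 := by
  rw [sinCoeff]
  intro h
  apply hp1
  field_simp at h
  linear_combination h

lemma branch_inv (x : ℂ) : (branch x)⁻¹ = x - root x := by
  apply inv_eq_of_mul_eq_one_right
  rw [branch, ← root]
  linear_combination -root_sq x

lemma joukowski_mul_branch (p x : ℂ) : joukowski (p * branch x) = nodePos p x := by
  rw [joukowski, mul_inv, branch_inv, branch, ← root, nodePos, cosCoeff, sinCoeff]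
  ring

lemma joukowski_inv_mul_branch (p x : ℂ) : joukowski (p⁻¹ * branch x) = nodeNeg p x := by
  rw [joukowski, mul_inv, inv_inv, branch_inv, branch, ← root, nodeNeg, cosCoeff, sinCoeff]
  ring

lemma nodePos_sub_nodeNeg (p x : ℂ) : nodePos p x - nodeNeg p x = 2 * sinCoeff p * root x := by
  rw [nodePos, nodeNeg]; ring

lemma awOp_apply {p : ℂ} {f : ℂ → ℂ} {x : ℂ} (h1 : x ≠ 1) (h2 : x ≠ -1) :
    awOp p f x = (f (nodePos p x) - f (nodeNeg p x)) / (2 * sinCoeff p * root x) := by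
  rw [awOp, if_neg (by tauto), quotient, breve, breve, breve, breve, joukowski_mul_branch,
    joukowski_inv_mul_branch, id, id, nodePos_sub_nodeNeg]

/-- A sign change of the root swaps the nodes and changes both numerator and denominator by a sign.
Hence a locally holomorphic root may replace the principal one, which jumps across its cut. -/
lemma awOp_apply_of_sq_eq {p : ℂ} {f : ℂ → ℂ} {x y : ℂ} (h1 : x ≠ 1) (h2 : x ≠ -1)
    (hy : y ^ 2 = x ^ 2 - 1) :
    awOp p f x = (f (cosCoeff p * x + sinCoeff p * y) - f (cosCoeff p * x - sinCoeff p * y)) /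
      (2 * sinCoeff p * y) := by
  rw [awOp_apply h1 h2, nodePos, nodeNeg]
  rw [← root_sq, sq_eq_sq_iff_eq_or_eq_neg] at hy
  rcases hy with rfl | rfl
  · rfl
  · rw [mul_neg, mul_neg, div_neg, ← neg_div, neg_sub, sub_neg_eq_add, ← sub_eq_add_neg]

/-- The quadratic polynomial in `x` equal to `(w₁ - b) (w₂ - b)`, where `w₁, w₂` are the nodes
at `x`. -/
def nodePoly (p b : ℂ) : ℂ[X] :=
  X ^ 2 - C (2 * b * cosCoeff p) * X + C (b ^ 2 + sinCoeff p ^ 2)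

lemma nodePoly_eval (p b x : ℂ) : (nodePoly p b).eval x =
    x ^ 2 - 2 * b * cosCoeff p * x + (b ^ 2 + sinCoeff p ^ 2) := by
  simp [nodePoly]

lemma nodePoly_eval_eq_mul {p : ℂ} (hp : p ≠ 0) (b x : ℂ) :
    (nodePoly p b).eval x = (nodePos p x - b) * (nodeNeg p x - b) := by
  rw [nodePoly_eval, nodePos, nodeNeg]
  linear_combination (sinCoeff p ^ 2) * root_sq x - x ^ 2 * cosCoeff_sq hp

lemma nodePoly_monic (p b : ℂ) : (nodePoly p b).Monic := by
  rw [nodePoly]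
  monicity!

lemma nodePoly_ne_zero (p b : ℂ) : nodePoly p b ≠ 0 := (nodePoly_monic p b).ne_zero

lemma _root_.Polynomial.eventually_nhdsNE_eval_ne_zero {P : ℂ[X]} (hP : P ≠ 0) (x₀ : ℂ) :
    ∀ᶠ x in 𝓝[≠] x₀, P.eval x ≠ 0 := by
  have h : {x | P.eval x = 0}.Finite := by
    refine P.roots.toFinset.finite_toSet.subset fun x hx => ?_
    simpa [hP] using hx
  exact nhdsNE_le_cofinite _ h.compl_mem_cofinite

lemma norm_nodePos_le (p x : ℂ) :
    ‖nodePos p x‖ ≤ (‖cosCoeff p‖ + ‖sinCoeff p‖) * (‖x‖ + 1) := by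
  rw [nodePos]
  refine (norm_add_le _ _).trans ?_
  rw [norm_mul, norm_mul, add_mul]
  gcongr
  · linarith
  · exact norm_root_le x

lemma norm_nodeNeg_le (p x : ℂ) :
    ‖nodeNeg p x‖ ≤ (‖cosCoeff p‖ + ‖sinCoeff p‖) * (‖x‖ + 1) := by
  rw [nodeNeg]
  refine (norm_sub_le _ _).trans ?_
  rw [norm_mul, norm_mul, add_mul]
  gcongr
  · linarith
  · exact norm_root_le x

/-- As `x → x₀`, a solution `w` of the symmetric equation of the nodes tends to the nodes at `x₀`,
without attaining them. -/
lemma eventually_of_nodePoly_eval_eq_zero {p : ℂ} (hp : p ≠ 0) (x₀ : ℂ) {P : ℂ → Prop}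
    (h1 : ∀ᶠ w in 𝓝[≠] nodePos p x₀, P w) (h2 : ∀ᶠ w in 𝓝[≠] nodeNeg p x₀, P w) :
    ∀ᶠ x in 𝓝[≠] x₀, ∀ w, (nodePoly p w).eval x = 0 →
      ‖w‖ ≤ (‖cosCoeff p‖ + ‖sinCoeff p‖) * (‖x‖ + 1) → P w := by
  obtain ⟨ε₁, hε₁, H1⟩ := Metric.mem_nhdsWithin_iff.1 h1
  obtain ⟨ε₂, hε₂, H2⟩ := Metric.mem_nhdsWithin_iff.1 h2
  set K := ‖cosCoeff p‖ + ‖sinCoeff p‖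
  have hcont : Tendsto (fun x : ℂ => ‖x₀ - x‖ *
      (‖x₀‖ + ‖x‖ + 2 * ‖cosCoeff p‖ * (K * (‖x‖ + 1)))) (𝓝[≠] x₀) (𝓝 0) := by
    have : Continuous (fun x : ℂ => ‖x₀ - x‖ *
      (‖x₀‖ + ‖x‖ + 2 * ‖cosCoeff p‖ * (K * (‖x‖ + 1)))) := by fun_prop
    have h := this.tendsto x₀
    rw [sub_self, norm_zero, zero_mul] at h
    exact h.mono_left nhdsWithin_le_nhds
  filter_upwards [hcont.eventually (gt_mem_nhds (mul_pos hε₁ hε₂)),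
    Polynomial.eventually_nhdsNE_eval_ne_zero (nodePoly_ne_zero p (nodePos p x₀)) x₀,
    Polynomial.eventually_nhdsNE_eval_ne_zero (nodePoly_ne_zero p (nodeNeg p x₀)) x₀]
    with x hx hne1 hne2 w hw hwb
  have hw1 : w ≠ nodePos p x₀ := by rintro rfl; exact hne1 hw
  have hw2 : w ≠ nodeNeg p x₀ := by rintro rfl; exact hne2 hw
  -- Both sides are the difference of `nodePoly p w` at `x₀` and at `x`, the latter value being
  -- zero. A small product forces one of the two distances to be small, so no continuity of the root
  -- is needed.
  have key : (nodePos p x₀ - w) * (nodeNeg p x₀ - w) =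
      (x₀ - x) * (x₀ + x - 2 * cosCoeff p * w) := by
    rw [← nodePoly_eval_eq_mul hp, ← sub_zero (eval x₀ _), ← hw, nodePoly_eval, nodePoly_eval]
    ring
  have hlt : ‖nodePos p x₀ - w‖ * ‖nodeNeg p x₀ - w‖ < ε₁ * ε₂ := by
    rw [← norm_mul, key, norm_mul]
    refine lt_of_le_of_lt ?_ hx
    gcongr
    calc ‖x₀ + x - 2 * cosCoeff p * w‖ ≤ ‖x₀‖ + ‖x‖ + ‖2 * cosCoeff p * w‖ :=
          (norm_sub_le _ _).trans (by gcongr; exact norm_add_le _ _)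
      _ = ‖x₀‖ + ‖x‖ + 2 * ‖cosCoeff p‖ * ‖w‖ := by simp
      _ ≤ _ := by gcongr
  rcases lt_or_ge ‖nodePos p x₀ - w‖ ε₁ with h | h
  · exact H1 ⟨by rwa [Metric.mem_ball, dist_comm, dist_eq_norm], hw1⟩
  · refine H2 ⟨?_, hw2⟩
    rw [Metric.mem_ball, dist_comm, dist_eq_norm]
    by_contra! h'
    exact absurd hlt (not_lt.2 (mul_le_mul h h' hε₂.le (norm_nonneg _)))

lemma eventually_nodes {p : ℂ} (hp : p ≠ 0) {x₀ : ℂ} {P : ℂ → Prop}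
    (h1 : ∀ᶠ w in 𝓝[≠] nodePos p x₀, P w) (h2 : ∀ᶠ w in 𝓝[≠] nodeNeg p x₀, P w) :
    ∀ᶠ x in 𝓝[≠] x₀, P (nodePos p x) ∧ P (nodeNeg p x) := by
  filter_upwards [eventually_of_nodePoly_eval_eq_zero hp x₀ h1 h2] with x hx
  exact ⟨hx _ (by rw [nodePoly_eval_eq_mul hp, sub_self, zero_mul]) (norm_nodePos_le p x),
    hx _ (by rw [nodePoly_eval_eq_mul hp, sub_self, mul_zero]) (norm_nodeNeg_le p x)⟩

lemma eventually_codiscrete_nodes {p : ℂ} (hp : p ≠ 0) {P : ℂ → Prop}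
    (h : ∀ᶠ w in codiscrete ℂ, P w) :
    ∀ᶠ x in codiscrete ℂ, P (nodePos p x) ∧ P (nodeNeg p x) := by
  have h' : ∀ w, ∀ᶠ z in 𝓝[≠] w, P z := fun w => by
    have := mem_codiscrete.1 h w
    rwa [disjoint_principal_right, compl_compl] at this
  refine mem_codiscrete.2 fun x => ?_
  rw [disjoint_principal_right, compl_compl]
  exact eventually_nodes hp (h' _) (h' _)

/-- Dividing by the value at `x₀` moves the argument of the power to `1`, away from the cut. -/
lemma exists_analyticAt_sqrt {x₀ : ℂ} (h1 : x₀ ≠ 1) (h2 : x₀ ≠ -1) :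
    ∃ y : ℂ → ℂ, AnalyticAt ℂ y x₀ ∧ y x₀ = root x₀ ∧ ∀ x, y x ^ 2 = x ^ 2 - 1 := by
  have hr := root_ne_zero h1 h2
  have hr2 : x₀ ^ 2 - 1 ≠ 0 := by rw [← root_sq]; exact pow_ne_zero 2 hr
  refine ⟨fun x => root x₀ * ((x ^ 2 - 1) / (x₀ ^ 2 - 1)) ^ (1 / 2 : ℂ), ?_, ?_, fun x => ?_⟩
  · refine analyticAt_const.mul (AnalyticAt.cpow ?_ analyticAt_const ?_)
    · exact AnalyticAt.div (by fun_prop) analyticAt_const hr2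
    · simp [div_self hr2]
  · simp [div_self hr2]
  · rw [mul_pow, root_sq, ← Complex.cpow_nat_mul]
    norm_num
    field_simp

lemma differentiableAt_awOp {p : ℂ} (hp : p ≠ 0) (hp1 : p ^ 2 ≠ 1) {f : ℂ → ℂ} {x₀ : ℂ}
    (h1 : x₀ ≠ 1) (h2 : x₀ ≠ -1) (hf1 : DifferentiableAt ℂ f (nodePos p x₀))
    (hf2 : DifferentiableAt ℂ f (nodeNeg p x₀)) : DifferentiableAt ℂ (awOp p f) x₀ := by
  obtain ⟨y, hy, hy0, hysq⟩ := exists_analyticAt_sqrt h1 h2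
  have hyd := hy.differentiableAt
  have hev : awOp p f =ᶠ[𝓝 x₀] fun x =>
      (f (cosCoeff p * x + sinCoeff p * y x) - f (cosCoeff p * x - sinCoeff p * y x)) /
      (2 * sinCoeff p * y x) := by
    filter_upwards [isOpen_ne.mem_nhds h1, isOpen_ne.mem_nhds h2] with x hx1 hx2
    exact awOp_apply_of_sq_eq hx1 hx2 (hysq x)
  refine DifferentiableAt.congr_of_eventuallyEq ?_ hev
  refine DifferentiableAt.fun_div (DifferentiableAt.fun_sub ?_ ?_) (by fun_prop) ?_
  · refine DifferentiableAt.fun_comp' (g := f) x₀ ?_ (by fun_prop)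
    rw [hy0]; exact hf1
  · refine DifferentiableAt.fun_comp' (g := f) x₀ ?_ (by fun_prop)
    rw [hy0]; exact hf2
  · rw [hy0]
    exact mul_ne_zero (mul_ne_zero two_ne_zero (sinCoeff_ne_zero hp hp1)) (root_ne_zero h1 h2)

lemma exists_bound_antisymm {g h : ℂ → ℂ} {e₁ e₂ : ℂ} (hg1 : AnalyticAt ℂ g e₁)
    (hg2 : AnalyticAt ℂ g e₂) (hh1 : AnalyticAt ℂ h e₁) (hh2 : AnalyticAt ℂ h e₂) :
    ∃ M : ℝ, 0 ≤ M ∧ ∃ S ∈ 𝓝 e₁, ∃ T ∈ 𝓝 e₂, ∀ w ∈ S ∪ T, ‖g w‖ ≤ M ∧ ‖h w‖ ≤ M := by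
  have H : ∀ k : ℂ → ℂ, ∀ e, AnalyticAt ℂ k e → ∀ᶠ w in 𝓝 e, ‖k w‖ ≤ ‖k e‖ + 1 := by
    intro k e hk
    have := hk.continuousAt.norm.eventually (gt_mem_nhds (lt_add_one ‖k e‖))
    filter_upwards [this] with w hw using hw.le
  have n1 := norm_nonneg (g e₁)
  have n2 := norm_nonneg (g e₂)
  have n3 := norm_nonneg (h e₁)
  have n4 := norm_nonneg (h e₂)
  refine ⟨‖g e₁‖ + ‖g e₂‖ + ‖h e₁‖ + ‖h e₂‖ + 1, by positivity,
    _, (H g e₁ hg1).and (H h e₁ hh1), _, (H g e₂ hg2).and (H h e₂ hh2), ?_⟩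
  rintro w (⟨a, b⟩ | ⟨a, b⟩) <;> constructor <;> linarith

lemma exists_lipschitz_antisymm {g h : ℂ → ℂ} {e : ℂ} (hg : AnalyticAt ℂ g e)
    (hh : AnalyticAt ℂ h e) :
    ∃ M : ℝ, 0 ≤ M ∧ ∃ S ∈ 𝓝 e, ∀ w₁ ∈ S, ∀ w₂ ∈ S,
      ‖g w₁ * h w₂ - g w₂ * h w₁‖ ≤ M * ‖w₁ - w₂‖ := by
  obtain ⟨K, s, hs, hK⟩ := hg.hasStrictFDerivAt.exists_lipschitzOnWith
  obtain ⟨K', s', hs', hK'⟩ := hh.hasStrictFDerivAt.exists_lipschitzOnWith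
  obtain ⟨M, hM, S, hS, T, hT, hST⟩ := exists_bound_antisymm hg hg hh hh
  refine ⟨K * M + M * K', by positivity, s ∩ s' ∩ S, inter_mem (inter_mem hs hs') hS, ?_⟩
  rintro w₁ ⟨⟨a1, a2⟩, a3⟩ w₂ ⟨⟨b1, b2⟩, b3⟩
  have e1 : g w₁ * h w₂ - g w₂ * h w₁ = (g w₁ - g w₂) * h w₂ - g w₂ * (h w₁ - h w₂) := by ring
  rw [e1, add_mul]
  have l1 := hK.dist_le_mul _ a1 _ b1
  have l2 := hK'.dist_le_mul _ a2 _ b2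
  rw [dist_eq_norm, dist_eq_norm] at l1 l2
  refine (norm_sub_le _ _).trans (add_le_add ?_ ?_)
  · rw [norm_mul]
    calc ‖g w₁ - g w₂‖ * ‖h w₂‖ ≤ (K * ‖w₁ - w₂‖) * M := by
          gcongr
          exact (hST w₂ (Or.inl b3)).2
      _ = _ := by ring
  · rw [norm_mul]
    calc ‖g w₂‖ * ‖h w₁ - h w₂‖ ≤ M * (K' * ‖w₁ - w₂‖) := by
          gcongr
          exact (hST w₂ (Or.inl b3)).1
      _ = _ := by ring

/-- The antisymmetric expression in the nodes is dominated by their difference. -/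
lemma exists_eventually_norm_le_mul {p : ℂ} (hp : p ≠ 0) (hp1 : p ^ 2 ≠ 1) {g h : ℂ → ℂ} {x₀ : ℂ}
    (hg1 : AnalyticAt ℂ g (nodePos p x₀)) (hg2 : AnalyticAt ℂ g (nodeNeg p x₀))
    (hh1 : AnalyticAt ℂ h (nodePos p x₀)) (hh2 : AnalyticAt ℂ h (nodeNeg p x₀)) :
    ∃ M : ℝ, 0 ≤ M ∧ ∀ᶠ x in 𝓝[≠] x₀,
      ‖g (nodePos p x) * h (nodeNeg p x) - g (nodeNeg p x) * h (nodePos p x)‖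
        ≤ M * ‖2 * sinCoeff p * root x‖ := by
  by_cases hx0 : root x₀ = 0
  -- The nodes coincide: the antisymmetric numerator vanishes on the diagonal and is Lipschitz
  -- there.
  · have e : nodeNeg p x₀ = nodePos p x₀ := by rw [nodePos, nodeNeg, hx0]; ring
    obtain ⟨M, hM, S, hS, H⟩ := exists_lipschitz_antisymm hg1 hh1
    refine ⟨M, hM, ?_⟩
    have hS' : ∀ᶠ w in 𝓝[≠] nodePos p x₀, w ∈ S := nhdsWithin_le_nhds hS
    filter_upwards [eventually_nodes hp hS' (e ▸ hS')] with x hx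
    rw [← nodePos_sub_nodeNeg]
    exact H _ hx.1 _ hx.2
  · obtain ⟨M, hM, S, hS, T, hT, H⟩ := exists_bound_antisymm hg1 hg2 hh1 hh2
    have hpos : 0 < ‖2 * sinCoeff p * root x₀‖ :=
      norm_pos_iff.2 (mul_ne_zero (mul_ne_zero two_ne_zero (sinCoeff_ne_zero hp hp1)) hx0)
    set δ := ‖2 * sinCoeff p * root x₀‖ with hδ
    -- The estimate goes through squares, since `root ^ 2` is continuous and `root` is not.
    have hnear : ∀ᶠ x in 𝓝[≠] x₀, (δ / 2) ^ 2 < ‖2 * sinCoeff p * root x‖ ^ 2 := by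
      have hc : Continuous fun x : ℂ => ‖(2 * sinCoeff p) ^ 2 * (x ^ 2 - 1)‖ := by fun_prop
      have h0 : (δ / 2) ^ 2 < ‖(2 * sinCoeff p) ^ 2 * (x₀ ^ 2 - 1)‖ := by
        rw [← root_sq, ← mul_pow, norm_pow, ← hδ]
        nlinarith
      filter_upwards [(hc.continuousAt.eventually (lt_mem_nhds h0)).filter_mono
        nhdsWithin_le_nhds] with x hx
      rwa [← root_sq, ← mul_pow, norm_pow] at hx
    have hS' : ∀ᶠ w in 𝓝[≠] nodePos p x₀, w ∈ S ∪ T :=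
      nhdsWithin_le_nhds (mem_of_superset hS Set.subset_union_left)
    have hT' : ∀ᶠ w in 𝓝[≠] nodeNeg p x₀, w ∈ S ∪ T :=
      nhdsWithin_le_nhds (mem_of_superset hT Set.subset_union_right)
    refine ⟨2 * M ^ 2 / (δ / 2), by positivity, ?_⟩
    filter_upwards [hnear, eventually_nodes hp hS' hT'] with x hx hST
    have h1 := lt_of_pow_lt_pow_left₀ 2 (norm_nonneg _) hx
    have b1 := H _ hST.1
    have b2 := H _ hST.2
    calc _ ≤ M * M + M * M := by
          refine (norm_sub_le _ _).trans ?_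
          rw [norm_mul, norm_mul]
          gcongr
          exacts [b1.1, b2.2, b2.1, b1.2]
      _ = 2 * M ^ 2 / (δ / 2) * (δ / 2) := by field_simp; ring
      _ ≤ _ := by gcongr

/-- The monic polynomial with the roots in `B`. -/
def rootPoly (B : Multiset ℂ) : ℂ[X] := (B.map fun b => X - C b).prod

/-- The polynomial in `x` equal to the product of the values of `rootPoly B` at the nodes. -/
def pairPoly (p : ℂ) (B : Multiset ℂ) : ℂ[X] := (B.map (nodePoly p)).prod

lemma pairPoly_monic (p : ℂ) (B : Multiset ℂ) : (pairPoly p B).Monic :=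
  monic_multiset_prod_of_monic _ _ fun b _ => nodePoly_monic p b

lemma pairPoly_eval {p : ℂ} (hp : p ≠ 0) (B : Multiset ℂ) (x : ℂ) :
    (pairPoly p B).eval x =
      (rootPoly B).eval (nodePos p x) * (rootPoly B).eval (nodeNeg p x) := by
  induction B using Multiset.induction with
  | empty => simp [pairPoly, rootPoly]
  | cons b B ih =>
    rw [pairPoly, rootPoly, Multiset.map_cons, Multiset.prod_cons, Multiset.map_cons,
      Multiset.prod_cons, eval_mul, eval_mul, eval_mul, ← pairPoly, ← rootPoly, ih,
      nodePoly_eval_eq_mul hp, eval_sub, eval_sub, eval_X, eval_C, eval_X, eval_C]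
    ring

/-- With `f = g / h` at the nodes, multiplication by `h(w₁)h(w₂)` leaves the antisymmetric numerator
`g(w₁)h(w₂) - g(w₂)h(w₁)`. -/
lemma awOp_mul_pairPoly_eval {p : ℂ} (hp : p ≠ 0) {f g : ℂ → ℂ} {B : Multiset ℂ} {x : ℂ}
    (h1 : x ≠ 1) (h2 : x ≠ -1)
    (hw1 : f (nodePos p x) * (rootPoly B).eval (nodePos p x) = g (nodePos p x))
    (hw2 : f (nodeNeg p x) * (rootPoly B).eval (nodeNeg p x) = g (nodeNeg p x)) :
    awOp p f x * (pairPoly p B).eval x =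
      (g (nodePos p x) * (rootPoly B).eval (nodeNeg p x)
        - g (nodeNeg p x) * (rootPoly B).eval (nodePos p x)) / (2 * sinCoeff p * root x) := by
  rw [awOp_apply h1 h2, pairPoly_eval hp, ← hw1, ← hw2]
  ring

/-- Clearing the poles of `f` at the nodes at `x₀` clears those of `awOp p f` at `x₀`. -/
theorem exists_analyticAt_awOp_mul_pairPoly {p : ℂ} (hp : p ≠ 0) (hp1 : p ^ 2 ≠ 1) {f g : ℂ → ℂ}
    (hf : Meromorphic f) {B : Multiset ℂ} {x₀ : ℂ}
    (hg1 : AnalyticAt ℂ g (nodePos p x₀)) (hg2 : AnalyticAt ℂ g (nodeNeg p x₀))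
    (hfg1 : ∀ᶠ w in 𝓝[≠] nodePos p x₀, f w * (rootPoly B).eval w = g w)
    (hfg2 : ∀ᶠ w in 𝓝[≠] nodeNeg p x₀, f w * (rootPoly B).eval w = g w) :
    ∃ G : ℂ → ℂ, AnalyticAt ℂ G x₀ ∧
      ∀ᶠ x in 𝓝[≠] x₀, awOp p f x * (pairPoly p B).eval x = G x := by
  set F : ℂ → ℂ := fun x => awOp p f x * (pairPoly p B).eval x with hF
  have hne : ∀ᶠ x in 𝓝[≠] x₀, x ≠ 1 ∧ x ≠ -1 := by
    have : ({1, -1} : Set ℂ).Finite := by simp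
    filter_upwards [nhdsNE_le_cofinite _ this.compl_mem_cofinite] with x hx
    simpa using hx
  have hdiff : ∀ᶠ x in 𝓝[≠] x₀, DifferentiableAt ℂ F x := by
    filter_upwards [hne, eventually_nodes hp (hf (nodePos p x₀)).eventually_analyticAt
      (hf (nodeNeg p x₀)).eventually_analyticAt] with x hx hfx
    exact (differentiableAt_awOp hp hp1 hx.1 hx.2 hfx.1.differentiableAt
      hfx.2.differentiableAt).mul (by fun_prop)
  obtain ⟨M, hM, hbd⟩ := exists_eventually_norm_le_mul (h := fun w => (rootPoly B).eval w)
    hp hp1 hg1 hg2 (AnalyticOnNhd.eval_polynomial _ _ (Set.mem_univ _))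
    (AnalyticOnNhd.eval_polynomial _ _ (Set.mem_univ _))
  have hbound : ∀ᶠ x in 𝓝[≠] x₀, ‖F x - F x₀‖ ≤ M + ‖F x₀‖ := by
    filter_upwards [hne, hbd, eventually_nodes hp hfg1 hfg2] with x hx hx1 hx2
    refine (norm_sub_le _ _).trans ?_
    gcongr
    simp only [hF]
    rw [awOp_mul_pairPoly_eval hp hx.1 hx.2 hx2.1 hx2.2, norm_div]
    exact div_le_of_le_mul₀ (norm_nonneg _) hM hx1
  -- Riemann's removable singularity theorem; it covers `x₀ = ±1` as well.
  have hlim := Complex.tendsto_limUnder_of_differentiable_on_punctured_nhds_of_bounded_under hdiff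
    ⟨_, eventually_map.2 hbound⟩
  refine ⟨Function.update F x₀ (limUnder (𝓝[≠] x₀) F), ?_, ?_⟩
  · refine Complex.analyticAt_of_differentiable_on_punctured_nhds_of_continuousAt ?_
      (continuousAt_update_same.2 hlim)
    filter_upwards [hdiff, self_mem_nhdsWithin] with x hx hxx
    refine hx.congr_of_eventuallyEq ?_
    filter_upwards [isOpen_ne.mem_nhds hxx] with z hz
    exact Function.update_of_ne hz _ _
  · filter_upwards [self_mem_nhdsWithin] with x hx
    rw [Function.update_of_ne hx]

theorem meromorphic_awOp {p : ℂ} (hp : p ≠ 0) (hp1 : p ^ 2 ≠ 1) {f : ℂ → ℂ}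
    (hf : Meromorphic f) : Meromorphic (awOp p f) := by
  intro x₀
  obtain ⟨m, hm⟩ := hf (nodePos p x₀)
  obtain ⟨n, hn⟩ := hf (nodeNeg p x₀)
  -- Enough copies of each node at `x₀` to cancel the possible poles of `f` there.
  set B : Multiset ℂ := Multiset.replicate m (nodePos p x₀) + Multiset.replicate n (nodeNeg p x₀)
  have hB : ∀ w, (rootPoly B).eval w = (w - nodePos p x₀) ^ m * (w - nodeNeg p x₀) ^ n := by
    intro w
    simp [B, rootPoly]
  obtain ⟨G, hG, hFG⟩ := exists_analyticAt_awOp_mul_pairPoly hp hp1 hf (B := B) (x₀ := x₀)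
    (g := fun w => f w * (rootPoly B).eval w) (by
      have := hm.mul (g := fun w => (w - nodeNeg p x₀) ^ n) (by fun_prop)
      refine this.congr (Eventually.of_forall fun w => ?_)
      simp only [Pi.mul_apply, smul_eq_mul, hB]
      ring) (by
      have := hn.mul (g := fun w => (w - nodePos p x₀) ^ m) (by fun_prop)
      refine this.congr (Eventually.of_forall fun w => ?_)
      simp only [Pi.mul_apply, smul_eq_mul, hB]
      ring) (Eventually.of_forall fun _ => rfl) (Eventually.of_forall fun _ => rfl)
  have hP : MeromorphicAt (fun x => (pairPoly p B).eval x) x₀ :=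
    (AnalyticOnNhd.eval_polynomial _ _ (Set.mem_univ _)).meromorphicAt
  refine (hG.meromorphicAt.div hP).congr ?_
  filter_upwards [hFG, Polynomial.eventually_nhdsNE_eval_ne_zero (pairPoly_monic p B).ne_zero x₀]
    with x hx hx0
  rw [Pi.div_apply, ← hx, mul_div_cancel_right₀ _ hx0]

theorem meromorphic_iterate_awOp {p : ℂ} (hp : p ≠ 0) (hp1 : p ^ 2 ≠ 1) {f : ℂ → ℂ}
    (hf : Meromorphic f) (j : ℕ) : Meromorphic ((awOp p)^[j] f) := by
  induction j with
  | zero => exact hf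
  | succ j ih =>
    rw [Function.iterate_succ_apply']
    exact meromorphic_awOp hp hp1 ih

end AskeyWilson
end

/-! ### Counting functions, Jensen's formula and the Mahler measure of the pole polynomial. -/

noncomputable section
namespace AskeyWilson

open Polynomial Real Metric MeromorphicOn ValueDistribution Function.locallyFinsuppWithin

lemma logCounting_eq_zero_of_eqOn {D : Function.locallyFinsupp ℂ ℤ} {r : ℝ}
    (h : ∀ z ∈ closedBall (0 : ℂ) |r|, D z = 0) : Function.locallyFinsuppWithin.logCounting D r = 0 := by
  have h1 : ∀ z, toClosedBall r D z = 0 := by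
    intro z
    by_cases hz : z ∈ closedBall (0 : ℂ) |r|
    · rw [toClosedBall_eval_within D hz, h z hz]
    · exact apply_eq_zero_of_notMem _ hz
  simp [Function.locallyFinsuppWithin.logCounting, h1, h 0 (by simp)]

lemma logCounting_top_eq_zero_of_order_nonneg {f : ℂ → ℂ} (hf : Meromorphic f) {r : ℝ}
    (h : ∀ z ∈ closedBall (0 : ℂ) |r|, 0 ≤ meromorphicOrderAt f z) :
    ValueDistribution.logCounting f ⊤ r = 0 := by
  rw [logCounting_top]
  apply logCounting_eq_zero_of_eqOn
  intro z hz
  rw [negPart_apply, divisor_apply hf.meromorphicOn (Set.mem_univ z), negPart_eq_zero]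
  exact WithTop.untop₀_nonneg.2 (h z hz)

/-- The increment of the counting function of the poles is submultiplicative. -/
lemma logCounting_mul_top_sub_le {f g : ℂ → ℂ} (hf : Meromorphic f) (hg : Meromorphic g)
    (hf' : ∀ z, meromorphicOrderAt f z ≠ ⊤) (hg' : ∀ z, meromorphicOrderAt g z ≠ ⊤) {r : ℝ}
    (hr : 1 ≤ r) :
    ValueDistribution.logCounting (f * g) ⊤ r - ValueDistribution.logCounting (f * g) ⊤ 1 ≤
      (ValueDistribution.logCounting f ⊤ r - ValueDistribution.logCounting f ⊤ 1) +
      (ValueDistribution.logCounting g ⊤ r - ValueDistribution.logCounting g ⊤ 1) := by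
  have h : 0 ≤ (divisor f Set.univ)⁻ + (divisor g Set.univ)⁻ - (divisor (f * g) Set.univ)⁻ := by
    rw [divisor_mul hf.meromorphicOn hg.meromorphicOn (fun z _ => hf' z) (fun z _ => hg' z),
      sub_nonneg]
    exact negPart_add _ _
  have := logCounting_mono h (Set.mem_Ioi.2 one_pos) (Set.mem_Ioi.2 (one_pos.trans_le hr)) hr
  simp only [map_sub, map_add, Pi.sub_apply, Pi.add_apply] at this
  simp only [logCounting_top]
  linarith

lemma meromorphic_eval (P : ℂ[X]) : Meromorphic fun x => P.eval x := fun x =>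
  (AnalyticOnNhd.eval_polynomial P x (Set.mem_univ x)).meromorphicAt

lemma meromorphicOrderAt_eval_ne_top {P : ℂ[X]} (hP : P ≠ 0) (x : ℂ) :
    meromorphicOrderAt (fun x => P.eval x) x ≠ ⊤ := by
  rw [meromorphicOrderAt_ne_top_iff_eventually_ne_zero (meromorphic_eval P x)]
  exact Polynomial.eventually_nhdsNE_eval_ne_zero hP x

/-- Jensen's formula for the reciprocal of a polynomial that is bounded by one on a circle. -/
lemma characteristic_inv_eval_sub_logCounting {P : ℂ[X]} {r : ℝ} (hr : 0 < r)
    (hP1 : ∀ x : ℂ, ‖x‖ = r → ‖P.eval x‖ ≤ 1) :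
    characteristic (fun x => P.eval x)⁻¹ ⊤ r -
      ValueDistribution.logCounting (fun x => P.eval x)⁻¹ ⊤ 1 = -P.logMahlerMeasure := by
  have hm := meromorphic_eval P
  have hN : ∀ s, ValueDistribution.logCounting (fun x => P.eval x) ⊤ s = 0 := fun s =>
    logCounting_top_eq_zero_of_order_nonneg hm fun z _ =>
      (AnalyticOnNhd.eval_polynomial P z (Set.mem_univ z)).meromorphicOrderAt_nonneg
  have h1 := characteristic_sub_characteristic_inv_of_ne_zero hm hr.ne'
  have h2 := logCounting_zero_sub_logCounting_top_eq_circleAverage_sub_const hm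
    (one_ne_zero : (1 : ℝ) ≠ 0)
  have h3 : proximity (fun x => P.eval x) ⊤ r = 0 := by
    rw [proximity_top]
    rw [circleAverage_congr_sphere (f₂ := fun _ => (0 : ℝ)), circleAverage_const]
    intro x hx
    rw [mem_sphere_zero_iff_norm, abs_of_pos hr] at hx
    rw [posLog_eq_zero_iff, abs_of_nonneg (norm_nonneg _)]
    exact hP1 x hx
  rw [Pi.sub_apply, hN 1, sub_zero, ← logCounting_inv, ← logMahlerMeasure_def] at h2
  have h4 : characteristic (fun x => P.eval x) ⊤ r = 0 := by
    rw [characteristic, Pi.add_apply, h3, hN r, add_zero]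
  rw [h4] at h1
  linarith

/-- The Mahler measure of a monic polynomial is at least `1`, and it dominates the constant
coefficient `b² + sinCoeff p ^ 2`. -/
lemma max_sq_le_mahlerMeasure_nodePoly (p b : ℂ) :
    (max 1 ‖b‖) ^ 2 ≤ (1 + ‖sinCoeff p‖ ^ 2) * (nodePoly p b).mahlerMeasure := by
  have h1 : 1 ≤ (nodePoly p b).mahlerMeasure :=
    one_le_mahlerMeasure_of_one_le_norm_leadingCoeff (by rw [(nodePoly_monic p b).leadingCoeff]; simp)
  have h2 : ‖b ^ 2 + sinCoeff p ^ 2‖ ≤ (nodePoly p b).mahlerMeasure := by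
    have := norm_coeff_le_choose_mul_mahlerMeasure 0 (nodePoly p b)
    rw [coeff_zero_eq_eval_zero, nodePoly_eval] at this
    simpa using this
  have h3 : ‖b‖ ^ 2 ≤ ‖b ^ 2 + sinCoeff p ^ 2‖ + ‖sinCoeff p‖ ^ 2 := by
    rw [← norm_pow, ← norm_pow]
    calc ‖b ^ 2‖ = ‖b ^ 2 + sinCoeff p ^ 2 - sinCoeff p ^ 2‖ := by rw [add_sub_cancel_right]
      _ ≤ _ := norm_sub_le _ _
  have h4 : 0 ≤ ‖sinCoeff p‖ ^ 2 := by positivity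
  rcases le_total 1 ‖b‖ with h | h
  · rw [max_eq_right h]; nlinarith
  · rw [max_eq_left h]; nlinarith

/-- The logarithmic Mahler measure is additive over the quadratic factors, so each pole contributes
separately with a loss independent of the pole. -/
lemma sum_le_logMahlerMeasure_pairPoly (p : ℂ) (B : Multiset ℂ) :
    (B.map fun b => 2 * log (max 1 ‖b‖) - log (1 + ‖sinCoeff p‖ ^ 2)).sum
      ≤ (pairPoly p B).logMahlerMeasure := by
  induction B using Multiset.induction with
  | empty => simp [pairPoly]
  | cons b B ih =>
    have hne : nodePoly p b * pairPoly p B ≠ 0 :=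
      mul_ne_zero (nodePoly_ne_zero p b) (pairPoly_monic p B).ne_zero
    rw [Multiset.map_cons, Multiset.sum_cons, pairPoly, Multiset.map_cons, Multiset.prod_cons,
      ← pairPoly, logMahlerMeasure_mul_eq_add_logMahlerMeasure hne]
    refine add_le_add ?_ ih
    have hpos : 0 < max 1 ‖b‖ := lt_max_of_lt_left one_pos
    have hpos2 : 0 < 1 + ‖sinCoeff p‖ ^ 2 := by positivity
    have := log_le_log (by positivity) (max_sq_le_mahlerMeasure_nodePoly p b)
    rw [log_pow, log_mul hpos2.ne' (mahlerMeasure_pos_of_ne_zero (nodePoly_ne_zero p b)).ne',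
      ← logMahlerMeasure_eq_log_MahlerMeasure] at this
    push_cast at this
    linarith

lemma norm_rootPoly_eval_le {B : Multiset ℂ} {ρ : ℝ} {w : ℂ} (hB : ∀ b ∈ B, ‖b‖ ≤ ρ)
    (hw : ‖w‖ ≤ ρ) : ‖(rootPoly B).eval w‖ ≤ (2 * ρ) ^ Multiset.card B := by
  induction B using Multiset.induction with
  | empty => simp [rootPoly]
  | cons b B ih =>
    rw [rootPoly, Multiset.map_cons, Multiset.prod_cons, ← rootPoly, eval_mul, norm_mul,
      Multiset.card_cons, pow_succ']
    have hρ : 0 ≤ ρ := (norm_nonneg w).trans hw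
    gcongr
    · rw [eval_sub, eval_X, eval_C]
      linarith [norm_sub_le w b, hB b (Multiset.mem_cons_self b B)]
    · exact ih fun b hb => hB b (Multiset.mem_cons_of_mem hb)

/-- The poles of a meromorphic function in a disk, with multiplicities. -/
lemma exists_multiset_poles (f : ℂ → ℂ) {ρ : ℝ} (hρ : 1 ≤ ρ) :
    ∃ B : Multiset ℂ, (∀ b ∈ B, ‖b‖ ≤ ρ) ∧
      (∀ w : ℂ, ‖w‖ ≤ ρ → -divisor f Set.univ w ≤ B.count w) ∧
      (B.map fun b => log (2 * ρ) - log (max 1 ‖b‖)).sum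
        ≤ ValueDistribution.logCounting f ⊤ (2 * ρ) := by
  classical
  have hρ0 : 0 ≤ ρ := by linarith
  set D := (divisor f Set.univ)⁻ with hD
  have hfin : (toClosedBall ρ D).support.Finite :=
    (toClosedBall ρ D).finiteSupport (isCompact_closedBall 0 |ρ|)
  set S := hfin.toFinset with hS
  have hSmem : ∀ w, w ∈ S ↔ ‖w‖ ≤ ρ ∧ D w ≠ 0 := by
    intro w
    rw [hS, Set.Finite.mem_toFinset, Function.mem_support]
    by_cases hw : w ∈ closedBall (0 : ℂ) |ρ|
    · rw [toClosedBall_eval_within D hw]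
      rw [mem_closedBall_zero_iff, abs_of_nonneg hρ0] at hw
      simp [hw]
    · rw [apply_eq_zero_of_notMem _ hw]
      rw [mem_closedBall_zero_iff, abs_of_nonneg hρ0] at hw
      simp [hw]
  have hD0 : 0 ≤ D := negPart_nonneg _
  have hD0' : ∀ w, 0 ≤ D w := fun w => hD0 w
  refine ⟨∑ b ∈ S, Multiset.replicate (D b).toNat b, ?_, ?_, ?_⟩
  · intro b hb
    obtain ⟨c, hc, hbc⟩ := Multiset.mem_sum.1 hb
    rw [Multiset.eq_of_mem_replicate hbc]
    exact ((hSmem c).1 hc).1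
  · intro w hw
    have h1 : -divisor f Set.univ w ≤ D w := by
      rw [hD, negPart_apply]
      exact neg_le_negPart _
    refine h1.trans ?_
    by_cases h0 : D w = 0
    · rw [h0]; positivity
    · have hwS : w ∈ S := (hSmem w).2 ⟨hw, h0⟩
      have h2 : (D w).toNat ≤
          (∑ b ∈ S, Multiset.replicate (D b).toNat b).count w := by
        rw [Multiset.count_sum']
        refine le_trans ?_ (Finset.single_le_sum (fun _ _ => Nat.zero_le _) hwS)
        simp
      have := hD0' w
      omega
  · have hle : ∑ b ∈ S, Function.locallyFinsuppWithin.single b (D b) ≤ D := by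
      intro z
      rw [coe_sum, Finset.sum_apply]
      by_cases hz : z ∈ S
      · rw [Finset.sum_eq_single z]
        · simp
        · intro b _ hb
          simp [single_apply, Ne.symm hb]
        · exact fun h => absurd hz h
      · rw [Finset.sum_eq_zero]
        · exact hD0 z
        · intro b hb
          have : z ≠ b := by rintro rfl; exact hz hb
          simp [single_apply, this]
    have h1 := logCounting_le hle (r := 2 * ρ) (by linarith)
    rw [map_sum, Finset.sum_apply] at h1
    rw [logCounting_top]
    refine le_trans ?_ h1
    rw [← Multiset.coe_mapAddMonoidHom, map_sum, ← Multiset.coe_sumAddMonoidHom, map_sum]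
    simp only [Multiset.coe_mapAddMonoidHom, Multiset.coe_sumAddMonoidHom]
    refine Finset.sum_le_sum fun b hb => ?_
    have hbρ := ((hSmem b).1 hb).1
    rw [logCounting_single_eq_log_sub_const (by linarith), Multiset.map_replicate,
      Multiset.sum_replicate, nsmul_eq_mul]
    have hcast : (((D b).toNat : ℕ) : ℝ) = ((D b : ℤ) : ℝ) := by
      exact_mod_cast Int.toNat_of_nonneg (hD0' b)
    rw [hcast]
    have : (0 : ℝ) ≤ ((D b : ℤ) : ℝ) := by exact_mod_cast hD0' b
    refine mul_le_mul_of_nonneg_left (sub_le_sub_left ?_ _) this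
    -- A pole at the origin is harmless because `log 0 = 0` matches the term `log r` of the counting
    -- function.
    rcases (norm_nonneg b).eq_or_lt with h | h
    · simp [← h]
    · exact log_le_log h (le_max_right _ _)

/-- Multiplying with `rootPoly B` clears the poles counted by `B`. -/
lemma meromorphicOrderAt_mul_rootPoly_nonneg {f : ℂ → ℂ} (hf : Meromorphic f) {B : Multiset ℂ}
    {w : ℂ} (hB : -divisor f Set.univ w ≤ B.count w) :
    0 ≤ meromorphicOrderAt (f * fun z => (rootPoly B).eval z) w := by
  classical
  have hdvd : (X - C w) ^ B.count w ∣ rootPoly B := by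
    have h1 : Multiset.replicate (B.count w) w ≤ B := Multiset.le_count_iff_replicate_le.1 le_rfl
    have h2 := Multiset.prod_dvd_prod_of_le (Multiset.map_le_map (f := fun b : ℂ => X - C b) h1)
    rwa [Multiset.map_replicate, Multiset.prod_replicate] at h2
  obtain ⟨Q, hQ⟩ := hdvd
  have hQ0 := (AnalyticOnNhd.eval_polynomial Q w (Set.mem_univ w)).meromorphicOrderAt_nonneg
  have hfun : (fun z => (rootPoly B).eval z)
      = (fun z => z - w) ^ B.count w * fun z => Q.eval z := by
    ext z
    simp [hQ]
  have hpow : meromorphicOrderAt ((fun z => z - w) ^ B.count w) w = (B.count w : ℤ) := by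
    rw [meromorphicOrderAt_eq_int_iff (by fun_prop)]
    exact ⟨fun _ => 1, analyticAt_const, one_ne_zero, by simp⟩
  rw [hfun, meromorphicOrderAt_mul (hf w) ((by fun_prop : MeromorphicAt _ w).mul
    (meromorphic_eval Q w)), meromorphicOrderAt_mul (by fun_prop) (meromorphic_eval Q w), hpow,
    ← add_assoc]
  refine add_nonneg ?_ hQ0
  rw [divisor_apply hf.meromorphicOn (Set.mem_univ w)] at hB
  cases h : meromorphicOrderAt f w with
  | top => simp
  | coe n =>
    rw [h, WithTop.untop₀_coe] at hB
    have : (0 : ℤ) ≤ n + B.count w := by linarith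
    exact_mod_cast this

end AskeyWilson
end

/-! ### The characteristic of one application of the operator. -/

noncomputable section
namespace AskeyWilson

open Polynomial Real Metric MeromorphicOn ValueDistribution Function.locallyFinsuppWithin

lemma eventually_nhdsNE_of_codiscrete {P : ℂ → Prop} (h : ∀ᶠ z in codiscrete ℂ, P z) (w : ℂ) :
    ∀ᶠ z in 𝓝[≠] w, P z := by
  have := mem_codiscrete.1 h w
  rwa [disjoint_principal_right, compl_compl] at this

lemma codiscreteWithin_le_codiscrete (S : Set ℂ) : codiscreteWithin S ≤ codiscrete ℂ :=
  codiscreteWithin_mono (Set.subset_univ S)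

/-- A function bounded off a discrete set on a circle has bounded proximity function. -/
lemma proximity_top_le_of_codiscrete {f : ℂ → ℂ} (hf : Meromorphic f) {r A : ℝ} (hr : 0 < r)
    (h : ∀ᶠ x in codiscrete ℂ, ‖x‖ = r → log⁺ ‖f x‖ ≤ A) : proximity f ⊤ r ≤ A := by
  have hint : CircleIntegrable (fun x => log⁺ ‖f x‖) 0 r :=
    hf.meromorphicOn.circleIntegrable_posLog_norm
  have hev : (fun x => log⁺ ‖f x‖) =ᶠ[codiscreteWithin (sphere 0 |r|)]
      fun x => min (log⁺ ‖f x‖) A := by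
    filter_upwards [h.filter_mono (codiscreteWithin_le_codiscrete _),
      self_mem_codiscreteWithin (sphere (0 : ℂ) |r|)] with x hx hxr
    rw [mem_sphere_zero_iff_norm, abs_of_pos hr] at hxr
    exact (min_eq_left (hx hxr)).symm
  rw [proximity_top, circleAverage_congr_codiscreteWithin hev hr.ne']
  exact circleAverage_mono_on_of_le_circle (hint.congr_codiscreteWithin hev)
    fun x _ => min_le_right _ _

lemma one_le_norm_root {x : ℂ} (hx : 2 ≤ ‖x‖) : 1 ≤ ‖root x‖ := by
  have h1 : ‖x ^ 2‖ - ‖(1 : ℂ)‖ ≤ ‖root x‖ ^ 2 := by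
    rw [← norm_pow, root_sq]; exact norm_sub_norm_le _ _
  rw [norm_pow, norm_one] at h1
  nlinarith [norm_nonneg (root x)]

/-- A bound for the growth of the nodes. -/
def nodeBound (p : ℂ) : ℝ := 2 * (‖cosCoeff p‖ + ‖sinCoeff p‖) + 1

lemma one_le_nodeBound (p : ℂ) : 1 ≤ nodeBound p := by
  rw [nodeBound]
  linarith [norm_nonneg (cosCoeff p), norm_nonneg (sinCoeff p)]

lemma norm_nodes_le {p x : ℂ} {r : ℝ} (hr : 1 ≤ r) (hx : ‖x‖ ≤ r) :
    ‖nodePos p x‖ ≤ nodeBound p * r ∧ ‖nodeNeg p x‖ ≤ nodeBound p * r := by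
  have h : (‖cosCoeff p‖ + ‖sinCoeff p‖) * (‖x‖ + 1) ≤ nodeBound p * r := by
    rw [nodeBound]
    nlinarith [norm_nonneg (cosCoeff p), norm_nonneg (sinCoeff p), norm_nonneg x]
  exact ⟨(norm_nodePos_le p x).trans h, (norm_nodeNeg_le p x).trans h⟩

/-- A meromorphic function is, on a disk, the quotient of a bounded holomorphic function by a
polynomial with the poles as its zeros. -/
lemma exists_bounded_numerator {f : ℂ → ℂ} (hf : Meromorphic f) {R : ℝ} (hR : 1 ≤ R)
    {B : Multiset ℂ} (hB : ∀ b ∈ B, ‖b‖ ≤ 2 * R)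
    (hBf : ∀ w : ℂ, ‖w‖ ≤ 2 * R → -divisor f Set.univ w ≤ B.count w) :
    ∃ g : ℂ → ℂ, AnalyticOnNhd ℂ g (closedBall 0 (2 * R)) ∧
      (∀ᶠ w in codiscrete ℂ, f w * (rootPoly B).eval w = g w) ∧
      ∀ w : ℂ, ‖w‖ ≤ R →
        ‖g w‖ ≤ exp (3 * proximity f ⊤ (2 * R)) * (4 * R) ^ Multiset.card B := by
  set h : ℂ → ℂ := fun z => (rootPoly B).eval z with hh
  have hm : Meromorphic (f * h) := fun z => (hf z).mul (meromorphic_eval _ z)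
  set g := toMeromorphicNFOn (f * h) Set.univ with hg
  have hgm : MeromorphicNFOn g Set.univ := meromorphicNFOn_toMeromorphicNFOn _ _
  have han : AnalyticOnNhd ℂ g (closedBall 0 (2 * R)) := by
    intro w hw
    rw [← (hgm (Set.mem_univ w)).meromorphicOrderAt_nonneg_iff_analyticAt, hg,
      meromorphicOrderAt_toMeromorphicNFOn hm.meromorphicOn (Set.mem_univ w)]
    exact meromorphicOrderAt_mul_rootPoly_nonneg hf (hBf w (mem_closedBall_zero_iff.1 hw))
  have heq : ∀ᶠ w in codiscrete ℂ, f w * h w = g w :=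
    toMeromorphicNFOn_eqOn_codiscrete hm.meromorphicOn
  refine ⟨g, han, heq, fun w hw => ?_⟩
  have hL : 0 < (4 * R) ^ Multiset.card B := by positivity
  -- `L` bounds the pole polynomial on `|z| = 2R`, so `log⁺‖g / L‖ ≤ log⁺‖f‖` there off a discrete
  -- set. Normalising before the Poisson estimate keeps the factor `3` away from `log L`.
  set L : ℝ := (4 * R) ^ Multiset.card B with hLdef
  have hdiv : AnalyticOnNhd ℂ (fun z => g z / (L : ℂ)) (closedBall 0 (2 * R)) := fun z hz =>
    (han z hz).fun_div analyticAt_const (by exact_mod_cast hL.ne')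
  have h1 := posLog_norm_le_three_mul_circleAverage (by linarith) hdiv hw
  have h2 : circleAverage (fun z => log⁺ ‖g z / (L : ℂ)‖) 0 (2 * R) ≤ proximity f ⊤ (2 * R) := by
    have e : (fun z => log⁺ ‖g z / (L : ℂ)‖) =ᶠ[codiscreteWithin (sphere 0 |2 * R|)]
        fun z => log⁺ ‖f z * h z / (L : ℂ)‖ := by
      filter_upwards [heq.filter_mono (codiscreteWithin_le_codiscrete _)] with z hz
      rw [hz]
    rw [circleAverage_congr_codiscreteWithin e (by linarith), proximity_top]
    apply circleAverage_mono
    · apply MeromorphicOn.circleIntegrable_posLog_norm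
      exact fun z _ => (hm z).fun_div (MeromorphicAt.const _ _)
    · exact hf.meromorphicOn.circleIntegrable_posLog_norm
    · intro z hz
      rw [mem_sphere_zero_iff_norm, abs_of_pos (by linarith)] at hz
      refine posLog_le_posLog (norm_nonneg _) ?_
      rw [norm_div, norm_mul, Complex.norm_real, norm_of_nonneg hL.le, div_le_iff₀ hL]
      gcongr
      have := norm_rootPoly_eval_le hB hz.le
      rwa [show 2 * (2 * R) = 4 * R by ring] at this
  have h3 : log⁺ (‖g w‖ / L) ≤ 3 * proximity f ⊤ (2 * R) := by
    rw [norm_div, Complex.norm_real, norm_of_nonneg hL.le] at h1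
    linarith
  rw [← div_le_iff₀ hL]
  rcases (div_nonneg (norm_nonneg (g w)) hL.le).eq_or_lt with h0 | h0
  · rw [← h0]; positivity
  · rw [← log_le_iff_le_exp h0]
    exact (le_max_right _ _).trans h3

/-- Each `b` lies in the disk of radius `L / 2`, so its counting term is at least `log 2` and
absorbs the loss `κ`. -/
lemma sum_le_mul_sum (B : Multiset ℂ) {L κ : ℝ} (hκ : 0 ≤ κ) (hL : 2 ≤ L)
    (hB : ∀ b ∈ B, ‖b‖ ≤ L / 2) :
    Multiset.card B * (2 * log L) - (B.map fun b => 2 * log (max 1 ‖b‖) - κ).sum ≤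
      (2 + κ / log 2) * (B.map fun b => log L - log (max 1 ‖b‖)).sum := by
  induction B using Multiset.induction with
  | empty => simp
  | cons b B ih =>
    have ih' := ih fun c hc => hB c (Multiset.mem_cons_of_mem hc)
    rw [Multiset.card_cons, Multiset.map_cons, Multiset.sum_cons, Multiset.map_cons,
      Multiset.sum_cons, mul_add]
    push_cast
    have h2 : 0 < log 2 := log_pos one_lt_two
    have h1 : log 2 ≤ log L - log (max 1 ‖b‖) := by
      rw [← log_div (by positivity) (lt_max_of_lt_left one_pos).ne']
      refine log_le_log two_pos ?_
      rw [le_div_iff₀ (lt_max_of_lt_left one_pos)]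
      have := hB b (Multiset.mem_cons_self b B)
      have : max 1 ‖b‖ ≤ L / 2 := max_le (by linarith) this
      linarith
    have h3 : κ ≤ κ / log 2 * (log L - log (max 1 ‖b‖)) := by
      calc κ = κ / log 2 * log 2 := by field_simp
        _ ≤ _ := by gcongr
    linarith

lemma logCounting_le_characteristic (f : ℂ → ℂ) (r : ℝ) :
    ValueDistribution.logCounting f ⊤ r ≤ characteristic f ⊤ r :=
  le_add_of_nonneg_left (proximity_nonneg r)

lemma proximity_le_characteristic (f : ℂ → ℂ) {r : ℝ} (hr : 1 ≤ r) :
    proximity f ⊤ r ≤ characteristic f ⊤ r :=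
  le_add_of_nonneg_right (ValueDistribution.logCounting_nonneg hr)

/-- The characteristic function of `awOp p f` at a given radius. -/
lemma characteristic_awOp_le_proximity_add_logCounting {p : ℂ} (hp : p ≠ 0)
    (hp1 : p ^ 2 ≠ 1) {f : ℂ → ℂ} (hf : Meromorphic f) (htop : ∀ z, meromorphicOrderAt (awOp p f) z ≠ ⊤) {r : ℝ} (hr : 2 ≤ r) :
    characteristic (awOp p f) ⊤ r ≤
      ValueDistribution.logCounting (awOp p f) ⊤ 1
      + (3 * proximity f ⊤ (2 * (nodeBound p * r)) + log⁺ ‖(sinCoeff p)⁻¹‖)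
      + (2 + log (1 + ‖sinCoeff p‖ ^ 2) / log 2) *
        ValueDistribution.logCounting f ⊤ (4 * (nodeBound p * r)) := by
  have hr1 : 1 ≤ r := by linarith
  have hr0 : 0 < r := by linarith
  set R := nodeBound p * r with hRdef
  have hR : 1 ≤ R := by nlinarith [one_le_nodeBound p]
  have hd := sinCoeff_ne_zero hp hp1
  obtain ⟨B, hB, hBf, hBsum⟩ := exists_multiset_poles f (ρ := 2 * R) (by linarith)
  obtain ⟨g, hg, hfg, hgle⟩ := exists_bounded_numerator hf hR hB hBf
  set m := 3 * proximity f ⊤ (2 * R) with hm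
  set N := Multiset.card B
  set L : ℝ := (4 * R) ^ N with hLdef
  have hL : 0 < L := by positivity
  have hLc : ((L : ℂ) ^ 2)⁻¹ ≠ 0 := inv_ne_zero (pow_ne_zero 2 (by exact_mod_cast hL.ne'))
  set F := awOp p f with hF
  have hFm : Meromorphic F := meromorphic_awOp hp hp1 hf
  -- The factor `L⁻²` makes `P` bounded by one on `|x| = r`, so that its proximity function vanishes
  -- there.
  set P : ℂ[X] := C (((L : ℂ) ^ 2)⁻¹) * pairPoly p B with hPdef
  have hP : P ≠ 0 := mul_ne_zero (C_ne_zero.2 hLc) (pairPoly_monic p B).ne_zero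
  set H : ℂ → ℂ := fun x => P.eval x with hH
  have hHm : Meromorphic H := meromorphic_eval P
  set G : ℂ → ℂ := F * H with hG
  have hGm : Meromorphic G := fun z => (hFm z).mul (hHm z)
  have hh : ∀ w : ℂ, ‖w‖ ≤ R → ‖(rootPoly B).eval w‖ ≤ L := by
    intro w hw
    have := norm_rootPoly_eval_le hB (hw.trans (by linarith : R ≤ 2 * R))
    rwa [show 2 * (2 * R) = 4 * R by ring] at this
  have hH1 : ∀ x : ℂ, ‖x‖ = r → ‖P.eval x‖ ≤ 1 := by
    intro x hx
    obtain ⟨n1, n2⟩ := norm_nodes_le (p := p) hr1 hx.le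
    rw [hPdef, eval_mul, eval_C, pairPoly_eval hp, norm_mul, norm_mul, norm_inv, norm_pow,
      Complex.norm_real, norm_of_nonneg hL.le, inv_mul_le_iff₀ (by positivity), mul_one, sq]
    exact mul_le_mul (hh _ n1) (hh _ n2) (norm_nonneg _) hL.le
  have hHtop : ∀ z, meromorphicOrderAt H⁻¹ z ≠ ⊤ := by
    intro z
    rw [meromorphicOrderAt_inv]
    intro h
    exact meromorphicOrderAt_eval_ne_top hP z (by simpa using congrArg Neg.neg h)
  have hGtop : ∀ z, meromorphicOrderAt G z ≠ ⊤ := by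
    intro z
    rw [hG, meromorphicOrderAt_mul (hFm z) (hHm z)]
    exact WithTop.add_ne_top.2 ⟨htop z, meromorphicOrderAt_eval_ne_top hP z⟩
  have hFGH : F =ᶠ[codiscrete ℂ] G * H⁻¹ := by
    have : ∀ᶠ x in codiscrete ℂ, H x ≠ 0 :=
      hHm.meromorphicOn.eventually_codiscreteWithin_apply_ne_zero
        fun x _ => meromorphicOrderAt_eval_ne_top hP x
    filter_upwards [this] with x hx
    simp only [hG, Pi.mul_apply, Pi.inv_apply]
    rw [mul_inv_cancel_right₀ hx]
  -- For `|x| ≤ r` both nodes stay in the disk where `g` is holomorphic, so `G` has no poles there.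
  have hGN : ValueDistribution.logCounting G ⊤ r = 0 := by
    refine logCounting_top_eq_zero_of_order_nonneg hGm fun x hx => ?_
    rw [mem_closedBall_zero_iff, abs_of_pos hr0] at hx
    obtain ⟨n1, n2⟩ := norm_nodes_le (p := p) hr1 hx
    have hmem : ∀ w : ℂ, ‖w‖ ≤ R → w ∈ closedBall (0 : ℂ) (2 * R) := fun w hw => by
      rw [mem_closedBall_zero_iff]; linarith
    obtain ⟨G', hG', hGG'⟩ := exists_analyticAt_awOp_mul_pairPoly hp hp1 hf
      (hg _ (hmem _ n1)) (hg _ (hmem _ n2)) (eventually_nhdsNE_of_codiscrete hfg _)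
      (eventually_nhdsNE_of_codiscrete hfg _)
    have e : G =ᶠ[𝓝[≠] x] fun z => ((L : ℂ) ^ 2)⁻¹ * G' z := by
      filter_upwards [hGG'] with z hz
      rw [← hz]
      simp only [hG, hH, hPdef, Pi.mul_apply, eval_mul, eval_C]
      ring
    rw [meromorphicOrderAt_congr e]
    exact (analyticAt_const.fun_mul hG').meromorphicOrderAt_nonneg
  have hGprox : proximity G ⊤ r ≤ m + log⁺ ‖(sinCoeff p)⁻¹‖ := by
    refine proximity_top_le_of_codiscrete hGm hr0 ?_
    filter_upwards [eventually_codiscrete_nodes hp hfg] with x hx hxr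
    obtain ⟨n1, n2⟩ := norm_nodes_le (p := p) hr1 hxr.le
    have hx1 : x ≠ 1 := by rintro rfl; rw [norm_one] at hxr; linarith
    have hx2 : x ≠ -1 := by rintro rfl; rw [norm_neg, norm_one] at hxr; linarith
    have hroot := one_le_norm_root (x := x) (by linarith)
    have e : G x = ((L : ℂ) ^ 2)⁻¹ * ((g (nodePos p x) * (rootPoly B).eval (nodeNeg p x)
        - g (nodeNeg p x) * (rootPoly B).eval (nodePos p x)) / (2 * sinCoeff p * root x)) := by
      rw [← awOp_mul_pairPoly_eval hp hx1 hx2 hx.1 hx.2]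
      simp only [hG, hH, hPdef, Pi.mul_apply, eval_mul, eval_C]
      ring
    have hnum : ‖g (nodePos p x) * (rootPoly B).eval (nodeNeg p x)
        - g (nodeNeg p x) * (rootPoly B).eval (nodePos p x)‖ ≤ 2 * exp m * L ^ 2 := by
      refine (norm_sub_le _ _).trans ?_
      rw [norm_mul, norm_mul]
      have a1 := mul_le_mul (hgle _ n1) (hh _ n2) (norm_nonneg _) (by positivity)
      have a2 := mul_le_mul (hgle _ n2) (hh _ n1) (norm_nonneg _) (by positivity)
      linarith
    have hGx : ‖G x‖ ≤ exp m * ‖(sinCoeff p)⁻¹‖ := by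
      have hd' := norm_pos_iff.2 hd
      rw [e, norm_mul, norm_div, norm_mul, norm_mul, norm_inv, norm_pow, Complex.norm_real,
        norm_of_nonneg hL.le, norm_inv, Complex.norm_ofNat, inv_mul_le_iff₀ (by positivity),
        div_le_iff₀ (by positivity)]
      refine hnum.trans ?_
      calc 2 * exp m * L ^ 2 = 2 * exp m * L ^ 2 * 1 := (mul_one _).symm
        _ ≤ 2 * exp m * L ^ 2 * ‖root x‖ := by gcongr
        _ = _ := by field_simp
    refine (posLog_le_posLog (norm_nonneg _) hGx).trans (posLog_mul.trans ?_)
    gcongr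
    rw [posLog, log_exp]
    exact max_le (mul_nonneg (by norm_num) (proximity_nonneg _)) le_rfl
  have hHchar := characteristic_inv_eval_sub_logCounting hr0 hH1
  have hmahler : -P.logMahlerMeasure ≤ (2 + log (1 + ‖sinCoeff p‖ ^ 2) / log 2) *
      ValueDistribution.logCounting f ⊤ (4 * R) := by
    have hκ : 0 ≤ log (1 + ‖sinCoeff p‖ ^ 2) := log_nonneg (by nlinarith [norm_nonneg (sinCoeff p)])
    rw [hPdef, logMahlerMeasure_C_mul hLc (pairPoly_monic p B).ne_zero, norm_inv, norm_pow,
      Complex.norm_real, norm_of_nonneg hL.le, log_inv, log_pow, hLdef, log_pow]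
    have h1 := sum_le_logMahlerMeasure_pairPoly p B
    have h2 := sum_le_mul_sum B (L := 4 * R) hκ (by linarith)
      (fun b hb => (hB b hb).trans (by linarith))
    rw [show 2 * (2 * R) = 4 * R by ring] at hBsum
    have h3 := mul_le_mul_of_nonneg_left hBsum
      (by positivity : 0 ≤ 2 + log (1 + ‖sinCoeff p‖ ^ 2) / log 2)
    push_cast
    linarith
  -- Counting from radius `1` replaces the uncontrolled trailing coefficient of `P` at the origin by
  -- its Mahler measure. The price is the counting function of `awOp p f` at `1`, which does not
  -- depend on `r`.
  have hNN := logCounting_mul_top_sub_le hGm hHm.inv hGtop hHtop hr1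
  have hPP := proximity_mul_top_le hGm hHm.inv r
  have hG1 : 0 ≤ ValueDistribution.logCounting G ⊤ 1 := ValueDistribution.logCounting_nonneg le_rfl
  have e1 : ValueDistribution.logCounting F ⊤ 1 = ValueDistribution.logCounting (G * H⁻¹) ⊤ 1 := by
    rw [logCounting_congr_codiscrete hFGH]
  rw [characteristic_congr_codiscrete hFGH hr0.ne', e1]
  simp only [characteristic, Pi.add_apply] at hHchar hPP ⊢
  linarith

lemma eventually_codiscrete_eq_zero_of_order_eq_top {f : ℂ → ℂ} (hf : Meromorphic f)
    (h : ¬ ∀ z, meromorphicOrderAt f z ≠ ⊤) : f =ᶠ[codiscrete ℂ] fun _ => 0 := by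
  refine mem_codiscrete.2 fun x => ?_
  rw [disjoint_principal_right, compl_compl]
  refine meromorphicOrderAt_eq_top_iff.1 ?_
  by_contra hx
  exact h (hf.exists_meromorphicOrderAt_ne_top_iff_forall.1 ⟨x, hx⟩)

lemma characteristic_zero (r : ℝ) : characteristic (fun _ : ℂ => (0 : ℂ)) ⊤ r = 0 := by
  simp [characteristic]

/-- The Askey-Wilson operator increases the Nevanlinna characteristic at most by constant factors
in argument and value. -/
theorem exists_characteristic_awOp_le {p : ℂ} (hp : p ≠ 0) (hp1 : p ^ 2 ≠ 1) {f : ℂ → ℂ}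
    (hf : Meromorphic f) : ∃ C K : ℝ, 0 ≤ C ∧ 1 ≤ K ∧ ∀ r, 2 ≤ r →
      characteristic (awOp p f) ⊤ r ≤ C * characteristic f ⊤ (K * r) + C := by
  set κ := log (1 + ‖sinCoeff p‖ ^ 2) / log 2
  have hκ : 0 ≤ κ := by
    have : 0 ≤ log (1 + ‖sinCoeff p‖ ^ 2) := log_nonneg (by nlinarith [norm_nonneg (sinCoeff p)])
    positivity
  set A := ValueDistribution.logCounting (awOp p f) ⊤ 1 + log⁺ ‖(sinCoeff p)⁻¹‖
  have hA : 0 ≤ A := add_nonneg (ValueDistribution.logCounting_nonneg le_rfl) posLog_nonneg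
  -- The `5 + κ` collects `3` from the proximity term and `2 + κ` from the counting term.
  refine ⟨5 + κ + A, 4 * nodeBound p, by positivity, by linarith [one_le_nodeBound p],
    fun r hr => ?_⟩
  have hR : 2 ≤ nodeBound p * r := by nlinarith [one_le_nodeBound p]
  have hT := characteristic_nonneg (f := f) (a := ⊤) (r := 4 * nodeBound p * r) (by linarith)
  by_cases htop : ∀ z, meromorphicOrderAt (awOp p f) z ≠ ⊤
  · have h := characteristic_awOp_le_proximity_add_logCounting hp hp1 hf htop hr
    have h1 := (proximity_le_characteristic f (r := 2 * (nodeBound p * r)) (by linarith)).trans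
      (characteristic_monotoneOn hf (Set.mem_Ioi.2 (by linarith))
        (Set.mem_Ioi.2 (by linarith : (0 : ℝ) < 4 * nodeBound p * r)) (by linarith))
    have h2 := logCounting_le_characteristic f (4 * (nodeBound p * r))
    have e4 : 4 * (nodeBound p * r) = 4 * nodeBound p * r := by ring
    rw [e4] at h2 h
    have h3 := mul_le_mul_of_nonneg_left h2 (by positivity : 0 ≤ 2 + κ)
    have h4 := mul_nonneg hA hT
    have hAdef : A = ValueDistribution.logCounting (awOp p f) ⊤ 1 + log⁺ ‖(sinCoeff p)⁻¹‖ := rfl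
    have hκdef : log (1 + ‖sinCoeff p‖ ^ 2) / log 2 = κ := rfl
    rw [hκdef] at h
    linarith
  · rw [characteristic_congr_codiscrete
      (eventually_codiscrete_eq_zero_of_order_eq_top (meromorphic_awOp hp hp1 hf) htop)
      (by linarith), characteristic_zero]
    positivity

end AskeyWilson
end

/-! ### Iterates, the equation solved for its lowest coefficient, and vanishing characteristic. -/

noncomputable section
namespace AskeyWilson

open Polynomial Real Metric MeromorphicOn ValueDistribution Function.locallyFinsuppWithin

/-- If a factor vanishes identically, so does the product, and no condition on the orders is needed.
-/
lemma characteristic_mul_le {f g : ℂ → ℂ} (hf : Meromorphic f) (hg : Meromorphic g) {r : ℝ}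
    (hr : 1 ≤ r) :
    characteristic (f * g) ⊤ r ≤ characteristic f ⊤ r + characteristic g ⊤ r := by
  by_cases h1 : ∀ z, meromorphicOrderAt f z ≠ ⊤
  · by_cases h2 : ∀ z, meromorphicOrderAt g z ≠ ⊤
    · exact characteristic_mul_top_le hr hf h1 hg h2
    · have h0 : f * g =ᶠ[codiscrete ℂ] fun _ => 0 := by
        filter_upwards [eventually_codiscrete_eq_zero_of_order_eq_top hg h2] with x hx
        simp [hx]
      rw [characteristic_congr_codiscrete h0 (by linarith), characteristic_zero]
      exact add_nonneg (characteristic_nonneg hr) (characteristic_nonneg hr)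
  · have h0 : f * g =ᶠ[codiscrete ℂ] fun _ => 0 := by
      filter_upwards [eventually_codiscrete_eq_zero_of_order_eq_top hf h1] with x hx
      simp [hx]
    rw [characteristic_congr_codiscrete h0 (by linarith), characteristic_zero]
    exact add_nonneg (characteristic_nonneg hr) (characteristic_nonneg hr)

lemma characteristic_neg_le {f : ℂ → ℂ} (hf : Meromorphic f) {r : ℝ} (hr : 1 ≤ r) :
    characteristic (-f) ⊤ r ≤ characteristic f ⊤ r := by
  have h := characteristic_mul_le (f := fun _ => (-1 : ℂ)) (MeromorphicAt.const _) hf hr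
  have h0 : characteristic (fun _ : ℂ => (-1 : ℂ)) ⊤ r = 0 := by
    simp [characteristic]
  have e : (fun _ => (-1 : ℂ)) * f = -f := by ext x; simp
  rwa [h0, zero_add, e] at h

/-- Iterates of the Askey-Wilson operator increase the Nevanlinna characteristic at most by
constant factors, uniformly in the number of iterations up to `n`. -/
theorem exists_characteristic_iterate_awOp_le {p : ℂ} (hp : p ≠ 0) (hp1 : p ^ 2 ≠ 1) {f : ℂ → ℂ}
    (hf : Meromorphic f) (n : ℕ) : ∃ C K : ℝ, 0 ≤ C ∧ 1 ≤ K ∧ ∀ j ≤ n, ∀ r, 2 ≤ r →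
      characteristic ((awOp p)^[j] f) ⊤ r ≤ C * characteristic f ⊤ (K * r) + C := by
  induction n with
  | zero =>
    refine ⟨1, 1, zero_le_one, le_rfl, fun j hj r hr => ?_⟩
    obtain rfl : j = 0 := by omega
    simp
  | succ n ih =>
    obtain ⟨C, K, hC, hK, H⟩ := ih
    obtain ⟨C₁, K₁, hC₁, hK₁, H₁⟩ :=
      exists_characteristic_awOp_le hp hp1 (meromorphic_iterate_awOp hp hp1 hf n)
    refine ⟨C + C₁ * C + C₁, K * K₁, by positivity, by nlinarith, fun j hj r hr => ?_⟩
    have hKK : 1 ≤ K * K₁ := by nlinarith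
    have hT := characteristic_nonneg (f := f) (a := ⊤) (r := K * K₁ * r) (by nlinarith)
    rcases Nat.lt_or_ge n j with h | h
    · obtain rfl : j = n + 1 := by omega
      have h1 := H₁ r hr
      have h2 := H n le_rfl (K₁ * r) (by nlinarith)
      rw [← mul_assoc] at h2
      have h3 := mul_le_mul_of_nonneg_left h2 hC₁
      rw [Function.iterate_succ_apply']
      have h4 : 0 ≤ C * characteristic f ⊤ (K * K₁ * r) := mul_nonneg hC hT
      have h5 : 0 ≤ C₁ * characteristic f ⊤ (K * K₁ * r) := mul_nonneg hC₁ hT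
      linarith
    · have h1 := H j h r hr
      have h2 : characteristic f ⊤ (K * r) ≤ characteristic f ⊤ (K * K₁ * r) := by
        have hle : K * r ≤ K * K₁ * r := by
          have : 0 ≤ K * r := by positivity
          nlinarith
        exact characteristic_monotoneOn hf (Set.mem_Ioi.2 (by positivity))
          (Set.mem_Ioi.2 (by positivity)) hle
      have h3 := mul_le_mul_of_nonneg_left h2 hC
      have h4 : 0 ≤ C₁ * C * characteristic f ⊤ (K * K₁ * r) :=
        mul_nonneg (mul_nonneg hC₁ hC) hT
      have h5 : 0 ≤ C₁ * characteristic f ⊤ (K * K₁ * r) := mul_nonneg hC₁ hT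
      have h6 : 0 ≤ C₁ * C := mul_nonneg hC₁ hC
      linarith

/-- The characteristic function of the lowest coefficient is dominated by those of the other
coefficients and of the solution. -/
theorem exists_characteristic_coeff_zero_le {p : ℂ} (hp : p ≠ 0) (hp1 : p ^ 2 ≠ 1) {n : ℕ}
    {a : ℕ → ℂ → ℂ} (ha : ∀ j ≤ n + 1, Meromorphic (a j)) {f : ℂ → ℂ} (hf : Meromorphic f)
    (hf0 : ¬ MerEq f fun _ => 0)
    (hsol : MerEq (fun x => ∑ j ∈ Finset.range (n + 1), a j x * ((awOp p)^[j] f) x)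
      (a (n + 1))) :
    ∃ C K : ℝ, 0 ≤ C ∧ 1 ≤ K ∧ ∀ r, 2 ≤ r →
      characteristic (a 0) ⊤ r ≤ ∑ j ∈ Finset.range (n + 1), characteristic (a (j + 1)) ⊤ r
        + C * characteristic f ⊤ (K * r) + C := by
  obtain ⟨C, K, hC, hK, H⟩ := exists_characteristic_iterate_awOp_le hp hp1 hf n
  set A := max |log ‖f 0‖| |log ‖meromorphicTrailingCoeffAt f 0‖|
  have hA : 0 ≤ A := le_max_of_le_left (abs_nonneg _)
  have hlogn : 0 ≤ log n := log_natCast_nonneg n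
  have hlog2 : 0 ≤ log 2 := log_nonneg one_le_two
  have hftop : ∀ z, meromorphicOrderAt f z ≠ ⊤ := by
    by_contra h
    exact hf0 (eventually_codiscrete_eq_zero_of_order_eq_top hf h)
  set t : ℕ → ℂ → ℂ := fun j => a (j + 1) * (awOp p)^[j + 1] f with ht
  have htm : ∀ j ∈ Finset.range n, Meromorphic (t j) := fun j hj z =>
    (ha (j + 1) (by have := Finset.mem_range.1 hj; omega) z).mul
      (meromorphic_iterate_awOp hp hp1 hf (j + 1) z)
  have hsm : Meromorphic (∑ j ∈ Finset.range n, t j) := Meromorphic.sum htm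
  have hXm : Meromorphic (a (n + 1) + -∑ j ∈ Finset.range n, t j) := fun z =>
    (ha (n + 1) le_rfl z).add (hsm z).neg
  -- The equation is solved for `a 0`; the first main theorem then replaces `f⁻¹` by `f` at the cost
  -- of the constant `A`.
  have heq : a 0 =ᶠ[codiscrete ℂ] (a (n + 1) + -∑ j ∈ Finset.range n, t j) * f⁻¹ := by
    have hne : ∀ᶠ x in codiscrete ℂ, f x ≠ 0 :=
      hf.meromorphicOn.eventually_codiscreteWithin_apply_ne_zero fun x _ => hftop x
    filter_upwards [hsol, hne] with x hx hfx
    rw [Finset.sum_range_succ'] at hx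
    simp only [Function.iterate_zero, id_eq] at hx
    simp only [Pi.mul_apply, Pi.add_apply, Pi.neg_apply, Pi.inv_apply, Finset.sum_apply, ht]
    rw [← hx]
    field_simp
    ring
  refine ⟨n * C + 1 + (log n + log 2 + A), K, by positivity, hK, fun r hr => ?_⟩
  have hr1 : 1 ≤ r := by linarith
  have hKr : r ≤ K * r := by nlinarith
  have hT := characteristic_nonneg (f := f) (a := ⊤) (r := K * r) (by linarith)
  have hTmono : characteristic f ⊤ r ≤ characteristic f ⊤ (K * r) :=
    characteristic_monotoneOn hf (Set.mem_Ioi.2 (by linarith)) (Set.mem_Ioi.2 (by linarith)) hKr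
  have hinv : characteristic f⁻¹ ⊤ r ≤ characteristic f ⊤ r + A := by
    have := (abs_le.1 (characteristic_sub_characteristic_inv_le (R := r) hf)).1
    linarith
  have h1 := characteristic_mul_le hXm hf.inv hr1
  have h2 := characteristic_add_top_le (ha (n + 1) le_rfl) hsm.neg hr1
  have h3 := characteristic_neg_le hsm hr1
  have h4 := characteristic_sum_top_le (Finset.range n) t htm hr1
  rw [Finset.card_range, Finset.sum_apply] at h4
  have h5 : ∑ j ∈ Finset.range n, characteristic (t j) ⊤ r ≤
      ∑ j ∈ Finset.range n, (characteristic (a (j + 1)) ⊤ r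
        + (C * characteristic f ⊤ (K * r) + C)) := by
    refine Finset.sum_le_sum fun j hj => ?_
    have hj' := Finset.mem_range.1 hj
    refine (characteristic_mul_le (ha (j + 1) (by omega))
      (meromorphic_iterate_awOp hp hp1 hf (j + 1)) hr1).trans ?_
    gcongr
    exact H (j + 1) (by omega) r hr
  rw [Finset.sum_add_distrib, Finset.sum_const, Finset.card_range, nsmul_eq_mul] at h5
  rw [characteristic_congr_codiscrete heq (by linarith), Finset.sum_range_succ]
  have h6 : 0 ≤ (log n + log 2 + A) * characteristic f ⊤ (K * r) :=
    mul_nonneg (by positivity) hT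
  linarith

/-- A meromorphic function with vanishing characteristic function is constant. -/
theorem merEq_const_of_characteristic_eq_zero {f : ℂ → ℂ} (hf : Meromorphic f)
    (h : ∀ r, 1 ≤ r → characteristic f ⊤ r = 0) : ∃ c : ℂ, MerEq f fun _ => c := by
  have hN : ∀ r, 1 ≤ r → ValueDistribution.logCounting f ⊤ r = 0 := fun r hr =>
    le_antisymm ((logCounting_le_characteristic f r).trans (h r hr).le)
      (ValueDistribution.logCounting_nonneg hr)
  have hm : ∀ r, 1 ≤ r → proximity f ⊤ r = 0 := fun r hr =>
    le_antisymm ((proximity_le_characteristic f hr).trans (h r hr).le) (proximity_nonneg r)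
  have hpole : ∀ w, -divisor f Set.univ w ≤ 0 := by
    intro w
    obtain ⟨B, hB, hBf, hBsum⟩ := exists_multiset_poles f (le_max_left 1 ‖w‖)
    set ρ := max 1 ‖w‖
    have hρ : 1 ≤ ρ := le_max_left _ _
    rw [hN (2 * ρ) (by linarith)] at hBsum
    have hterm : ∀ b ∈ B, 0 < log (2 * ρ) - log (max 1 ‖b‖) := by
      intro b hb
      have hb' : max 1 ‖b‖ ≤ ρ := max_le hρ (hB b hb)
      exact sub_pos.2 (log_lt_log (lt_max_of_lt_left one_pos) (by linarith))
    -- A pole in the disk of radius `ρ` would contribute a positive amount to the counting function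
    -- at `2ρ`, which is zero.
    have hB0 : B = 0 := by
      by_contra hne
      obtain ⟨b, hb⟩ := Multiset.exists_mem_of_ne_zero hne
      obtain ⟨B', rfl⟩ := Multiset.exists_cons_of_mem hb
      rw [Multiset.map_cons, Multiset.sum_cons] at hBsum
      have h1 := hterm b hb
      have h2 : 0 ≤ (B'.map fun b => log (2 * ρ) - log (max 1 ‖b‖)).sum := by
        refine Multiset.sum_nonneg fun x hx => ?_
        obtain ⟨c, hc, rfl⟩ := Multiset.mem_map.1 hx
        exact (hterm c (Multiset.mem_cons_of_mem hc)).le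
      linarith
    simpa [hB0] using hBf w (le_max_right _ _)
  set g := toMeromorphicNFOn f Set.univ with hg
  have heq : f =ᶠ[codiscrete ℂ] g := toMeromorphicNFOn_eqOn_codiscrete hf.meromorphicOn
  have han : ∀ w, AnalyticAt ℂ g w := by
    intro w
    rw [← (meromorphicNFOn_toMeromorphicNFOn f Set.univ
      (Set.mem_univ w)).meromorphicOrderAt_nonneg_iff_analyticAt,
      meromorphicOrderAt_toMeromorphicNFOn hf.meromorphicOn (Set.mem_univ w)]
    have := hpole w
    rw [divisor_apply hf.meromorphicOn (Set.mem_univ w)] at this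
    exact WithTop.untop₀_nonneg.1 (by linarith)
  have hbd : ∀ w, ‖g w‖ ≤ 1 := by
    intro w
    set R := ‖w‖ + 1 with hR
    have hR1 : 1 ≤ R := by linarith [norm_nonneg w]
    -- With no poles and zero proximity the numerator bound is `exp 0 = 1` on every disk, and
    -- Liouville's theorem applies.
    obtain ⟨k, _, hfk, hk⟩ := exists_bounded_numerator hf hR1 (B := 0) (by simp)
      (fun w _ => by simpa using hpole w)
    have hev : ∀ᶠ z in 𝓝[≠] w, ‖g z‖ ≤ 1 := by
      have hball : ∀ᶠ z in 𝓝 w, z ∈ ball (0 : ℂ) R :=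
        isOpen_ball.eventually_mem (by rw [mem_ball_zero_iff, hR]; linarith)
      filter_upwards [eventually_nhdsNE_of_codiscrete heq w,
        eventually_nhdsNE_of_codiscrete hfk w, hball.filter_mono nhdsWithin_le_nhds]
        with z h1 h2 h3
      have h4 := hk z (mem_ball_zero_iff.1 h3).le
      rw [hm (2 * R) (by linarith)] at h4
      rw [← h1]
      simp only [rootPoly, Multiset.map_zero, Multiset.prod_zero, eval_one, mul_one] at h2
      rw [h2]
      simpa using h4
    exact le_of_tendsto ((han w).continuousAt.norm.tendsto.mono_left nhdsWithin_le_nhds) hev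
  have hconst := Differentiable.apply_eq_apply_of_bounded (f := g)
    (fun w => (han w).differentiableAt)
    ((isBounded_iff_forall_norm_le.2 ⟨1, by rintro _ ⟨w, rfl⟩; exact hbd w⟩))
  refine ⟨g 0, heq.trans (Eventually.of_forall fun z => hconst z 0)⟩

end AskeyWilson
end

/-! ### The `φ`-order and the comparison of growth. -/

noncomputable section
namespace AskeyWilson

open Real ValueDistribution

lemma IsGrowthFunction.tendsto_atTop {R₀ : ℝ} {φ : ℝ → ℝ} (hφ : IsGrowthFunction R₀ φ) :
    Tendsto φ atTop atTop := by
  refine Filter.tendsto_atTop.2 fun b => ?_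
  have h := hφ.unbounded
  rw [not_bddAbove_iff] at h
  obtain ⟨_, ⟨r₁, hr₁, rfl⟩, hb⟩ := h b
  filter_upwards [eventually_ge_atTop r₁] with r hr
  exact hb.le.trans (hφ.mono hr₁ (lt_of_lt_of_le hr₁ hr) hr)

/-- Rescaling the argument changes a subadditive growth function at most by a constant factor. -/
lemma IsGrowthFunction.exists_comp_mul_le {R₀ : ℝ} {φ : ℝ → ℝ} (hφ : IsGrowthFunction R₀ φ)
    (hsub : IsSubadditive φ) {K : ℝ} (hK : 1 ≤ K) :
    ∃ M : ℝ, 0 < M ∧ ∀ᶠ r in atTop, φ (K * r) ≤ M * φ r := by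
  obtain ⟨R₁, hR₁⟩ := hsub
  have hdouble : ∀ k : ℕ, ∀ r, R₁ ≤ r → 0 ≤ r → φ (2 ^ k * r) ≤ 2 ^ k * φ r := by
    intro k
    induction k with
    | zero => intro r _ _; simp
    | succ k ih =>
      intro r hr hr0
      have h1 : (1 : ℝ) ≤ 2 ^ k := one_le_pow₀ one_le_two
      have h2 : R₁ ≤ 2 ^ k * r := hr.trans (by nlinarith)
      have h3 := hR₁ _ _ h2 h2
      have h4 := ih r hr hr0
      rw [pow_succ, show (2 : ℝ) ^ k * 2 * r = 2 ^ k * r + 2 ^ k * r by ring]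
      linarith
  obtain ⟨k, hk⟩ := pow_unbounded_of_one_lt K (one_lt_two : (1 : ℝ) < 2)
  refine ⟨2 ^ k, by positivity, ?_⟩
  filter_upwards [eventually_ge_atTop R₁, eventually_ge_atTop 0, eventually_gt_atTop R₀]
    with r h1 h2 h3
  have hle : K * r ≤ 2 ^ k * r := by gcongr
  have h4 : R₀ < K * r := h3.trans_le (by nlinarith)
  exact (hφ.mono h4 (h4.trans_le hle) hle).trans (hdouble k r h1 h2)

lemma eventually_characteristic_le_rpow {φ : ℝ → ℝ} (hφ : Tendsto φ atTop atTop) {g : ℂ → ℂ}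
    {σ : ℝ} (h : phiOrder φ g < σ) : ∀ᶠ r in atTop, characteristic g ⊤ r ≤ φ r ^ σ := by
  filter_upwards [eventually_lt_of_limsup_lt h, hφ.eventually_gt_atTop 1] with r hr hφr
  have hlog := log_pos hφr
  rcases le_or_gt (characteristic g ⊤ r) 0 with h0 | h0
  · exact h0.trans (by positivity)
  · rw [ENNReal.log_ofReal_of_pos h0, ← EReal.coe_div, EReal.coe_lt_coe_iff,
      div_lt_iff₀ hlog] at hr
    rw [← log_le_log_iff h0 (by positivity), log_rpow (by linarith)]
    exact hr.le

lemma phiOrder_le_of_eventually_le_rpow {φ : ℝ → ℝ} (hφ : Tendsto φ atTop atTop) {g : ℂ → ℂ}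
    {τ : ℝ} (h : ∀ᶠ r in atTop, characteristic g ⊤ r ≤ φ r ^ τ) : phiOrder φ g ≤ τ := by
  refine limsup_le_of_le (by isBoundedDefault) ?_
  filter_upwards [h, hφ.eventually_gt_atTop 1] with r hr hφr
  have hlog := log_pos hφr
  rcases le_or_gt (characteristic g ⊤ r) 0 with h0 | h0
  · rw [ENNReal.ofReal_of_nonpos h0, ENNReal.log_zero, EReal.bot_div_of_pos_ne_top
      (by exact_mod_cast hlog) (EReal.coe_ne_top _)]
    exact bot_le
  · rw [ENNReal.log_ofReal_of_pos h0, ← EReal.coe_div, EReal.coe_le_coe_iff,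
      div_le_iff₀ hlog, ← log_rpow (by linarith)]
    exact log_le_log h0 hr

/-- The `φ`-order of a non-constant meromorphic function is non-negative. -/
lemma phiOrder_nonneg {φ : ℝ → ℝ} (hφ : Tendsto φ atTop atTop) {f : ℂ → ℂ} (hf : Meromorphic f)
    (hnc : ¬ ∃ c : ℂ, MerEq f fun _ => c) : 0 ≤ phiOrder φ f := by
  obtain ⟨r₀, hr₀, hT₀⟩ : ∃ r, 1 ≤ r ∧ characteristic f ⊤ r ≠ 0 := by
    by_contra! h
    exact hnc (merEq_const_of_characteristic_eq_zero hf h)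
  set c := characteristic f ⊤ r₀
  have hc : 0 < c := lt_of_le_of_ne (characteristic_nonneg hr₀) hT₀.symm
  -- The characteristic is eventually at least `c > 0`; since `log φ` is unbounded, this alone gives
  -- a lower bound tending to `0`, even for `c < 1`.
  have hlim : Tendsto (fun r => ((log c / log (φ r) : ℝ) : EReal)) atTop (𝓝 0) := by
    have : Tendsto (fun r => log c / log (φ r)) atTop (𝓝 0) :=
      (tendsto_log_atTop.comp hφ).const_div_atTop _
    exact (continuous_coe_real_ereal.tendsto _).comp this
  rw [← hlim.limsup_eq]
  refine limsup_le_limsup ?_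
  filter_upwards [eventually_ge_atTop r₀, hφ.eventually_gt_atTop 1] with r hr hφr
  have hlog := log_pos hφr
  have hle : c ≤ characteristic f ⊤ r :=
    characteristic_monotoneOn hf (Set.mem_Ioi.2 (by linarith)) (Set.mem_Ioi.2 (by linarith)) hr
  rw [ENNReal.log_ofReal_of_pos (hc.trans_le hle), ← EReal.coe_div, EReal.coe_le_coe_iff]
  gcongr

/-- Monotonicity of `φ` together with `r < s r` puts the quotient in `[0, 1]` once `φ r > 1`. -/
lemma alpha_mem_Icc {R₀ : ℝ} {φ s : ℝ → ℝ} (hφ : IsGrowthFunction R₀ φ)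
    (hs : IsScaleFunction R₀ s) : 0 ≤ alpha φ s ∧ alpha φ s ≤ 1 := by
  have hev : ∀ᶠ r in atTop, 0 ≤ log (φ r) / log (φ (s r)) ∧ log (φ r) / log (φ (s r)) ≤ 1 := by
    filter_upwards [hφ.tendsto_atTop.eventually_gt_atTop 1, hs.lt_self, eventually_gt_atTop R₀]
      with r h1 h2 h3
    have h4 : φ r ≤ φ (s r) := hφ.mono h3 (h3.trans h2) h2.le
    have h5 : log (φ r) ≤ log (φ (s r)) := log_le_log (by linarith) h4
    have h6 := log_pos h1
    exact ⟨div_nonneg h6.le (h6.le.trans h5), (div_le_one (by linarith)).2 h5⟩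
  constructor
  · refine le_liminf_of_le (by isBoundedDefault) ?_
    filter_upwards [hev] with r hr
    exact_mod_cast hr.1
  · refine liminf_le_of_frequently_le' (Eventually.frequently ?_)
    filter_upwards [hev] with r hr
    exact_mod_cast hr.2

/-- A dominating coefficient of positive `φ`-order forces the same `φ`-order on a function whose
rescaled characteristic bounds the one of the coefficient. -/
lemma phiOrder_le_of_characteristic_le {R₀ : ℝ} {φ : ℝ → ℝ} (hφ : IsGrowthFunction R₀ φ)
    (hsub : IsSubadditive φ) {n : ℕ} {a : ℕ → ℂ → ℂ} {f : ℂ → ℂ} {C K : ℝ} (hC : 0 ≤ C)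
    (hK : 1 ≤ K)
    (hT : ∀ r, 2 ≤ r → characteristic (a 0) ⊤ r ≤
      ∑ j ∈ Finset.range (n + 1), characteristic (a (j + 1)) ⊤ r
        + C * characteristic f ⊤ (K * r) + C)
    (hpos : 0 < phiOrder φ (a 0))
    (hdom : ∀ j ≤ n, phiOrder φ (a (j + 1)) < phiOrder φ (a 0)) :
    phiOrder φ (a 0) ≤ phiOrder φ f := by
  by_contra! hlt
  have hφt := hφ.tendsto_atTop
  have hmax : max 0 (max (phiOrder φ f)
      ((Finset.range (n + 1)).sup fun j => phiOrder φ (a (j + 1)))) < phiOrder φ (a 0) := by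
    refine max_lt hpos (max_lt hlt ((Finset.sup_lt_iff (bot_lt_of_lt hpos)).2 fun j hj => ?_))
    exact hdom j (by have := Finset.mem_range.1 hj; omega)
  -- Two real exponents are needed: `σ` bounds all competing functions, and the gap up to `τ`
  -- absorbs the constants. Both are real even if the order of `a 0` is infinite.
  obtain ⟨σ, hσ, hσ'⟩ := EReal.lt_iff_exists_real_btwn.1 hmax
  obtain ⟨τ, hστ, hτ⟩ := EReal.lt_iff_exists_real_btwn.1 hσ'
  rw [EReal.coe_lt_coe_iff] at hστ
  have hσ0 : 0 < σ := by exact_mod_cast (le_max_left _ _).trans_lt hσ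
  have hfσ : phiOrder φ f < σ := ((le_max_left _ _).trans (le_max_right _ _)).trans_lt hσ
  have haσ : ∀ j ∈ Finset.range (n + 1), phiOrder φ (a (j + 1)) < σ := fun j hj =>
    (((Finset.le_sup (f := fun j => phiOrder φ (a (j + 1))) hj).trans (le_max_right _ _)).trans
      (le_max_right _ _)).trans_lt hσ
  obtain ⟨M, hM, hφM⟩ := hφ.exists_comp_mul_le hsub hK
  have hKt : Tendsto (fun r => K * r) atTop atTop := tendsto_id.const_mul_atTop (by linarith)
  have hall : ∀ᶠ r in atTop, ∀ j ∈ Finset.range (n + 1),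
      characteristic (a (j + 1)) ⊤ r ≤ φ r ^ σ :=
    (Filter.eventually_all_finset _).2 fun j hj =>
      eventually_characteristic_le_rpow hφt (haσ j hj)
  have hbig : ∀ᶠ r in atTop, (n + 1 : ℝ) + C * M ^ σ + C ≤ φ r ^ (τ - σ) :=
    ((tendsto_rpow_atTop (sub_pos.2 hστ)).comp hφt).eventually_ge_atTop _
  refine absurd (phiOrder_le_of_eventually_le_rpow hφt (g := a 0) (τ := τ) ?_) (not_le.2 hτ)
  filter_upwards [hall, hbig, hφM, hφt.eventually_ge_atTop 1, eventually_ge_atTop 2,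
    hKt.eventually (eventually_characteristic_le_rpow hφt hfσ),
    hKt.eventually (hφt.eventually_gt_atTop 0)] with r h1 h2 h3 h4 h5 h6 h7
  have h8 : ∑ j ∈ Finset.range (n + 1), characteristic (a (j + 1)) ⊤ r ≤ (n + 1 : ℝ) * φ r ^ σ := by
    refine (Finset.sum_le_sum h1).trans_eq ?_
    simp
  have h9 : characteristic f ⊤ (K * r) ≤ M ^ σ * φ r ^ σ := by
    rw [← mul_rpow hM.le (by linarith)]
    exact h6.trans (rpow_le_rpow h7.le h3 hσ0.le)
  have h10 : (1 : ℝ) ≤ φ r ^ σ := one_le_rpow h4 hσ0.le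
  calc characteristic (a 0) ⊤ r
      ≤ (n + 1 : ℝ) * φ r ^ σ + C * (M ^ σ * φ r ^ σ) + C * φ r ^ σ := by
        refine (hT r h5).trans (add_le_add (add_le_add h8 ?_) ?_)
        · exact mul_le_mul_of_nonneg_left h9 hC
        · exact le_mul_of_one_le_right hC h10
    _ = ((n + 1 : ℝ) + C * M ^ σ + C) * φ r ^ σ := by ring
    _ ≤ φ r ^ (τ - σ) * φ r ^ σ := by gcongr
    _ = φ r ^ τ := by rw [← rpow_add (by linarith), sub_add_cancel]

end AskeyWilson
end

/-! ### The lower bound for the order of a solution. -/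

theorem theorem2p2
    -- `p` is a fixed square root `q^{1/2}` of `q`
    (q p : ℂ) (hq0 : 0 < ‖q‖) (hq1 : ‖q‖ < 1) (hp : p ^ 2 = q)
    (R₀ : ℝ) (φ s : ℝ → ℝ)
    (hφ : AskeyWilson.IsGrowthFunction R₀ φ) (hsub : AskeyWilson.IsSubadditive φ)
    (hs : AskeyWilson.IsScaleFunction R₀ s)
    (n : ℕ) (hn : 1 ≤ n) (a : ℕ → ℂ → ℂ)
    (ha : ∀ j ≤ n + 1, Meromorphic (a j))
    (ha0 : ¬ AskeyWilson.MerEq (fun x => a 0 x * a n x) (fun _ => 0))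
    (hfin : ∀ j ≤ n, AskeyWilson.phiOrder φ (a j) < ⊤)
    (hdom : ∀ j, 1 ≤ j → j ≤ n + 1 →
      AskeyWilson.phiOrder φ (a j) < AskeyWilson.phiOrder φ (a 0))
    (f : ℂ → ℂ) (hf : Meromorphic f)
    (hnc : ¬ ∃ c : ℂ, AskeyWilson.MerEq f (fun _ => c))
    (hsol : AskeyWilson.MerEq
      (fun x => ∑ j ∈ Finset.range (n + 1), a j x * ((AskeyWilson.awOp p)^[j] f) x)
      (a (n + 1))) :
    AskeyWilson.alpha φ s ^ (n - 1) * AskeyWilson.phiOrder φ (a 0)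
      ≤ AskeyWilson.phiOrder φ f := by
  have hp0 : p ≠ 0 := by
    rintro rfl
    rw [← hp] at hq0
    simp at hq0
  have hp1 : p ^ 2 ≠ 1 := by
    intro h
    rw [← hp, h, norm_one] at hq1
    exact lt_irrefl _ hq1
  obtain ⟨hα0, hα1⟩ := AskeyWilson.alpha_mem_Icc hφ hs
  have hf0 := AskeyWilson.phiOrder_nonneg hφ.tendsto_atTop hf hnc
  rcases le_or_gt (AskeyWilson.phiOrder φ (a 0)) 0 with h0 | h0
  · exact (mul_nonpos_of_nonneg_of_nonpos (pow_nonneg hα0 _) h0).trans hf0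
  · obtain ⟨C, K, hC, hK, hT⟩ := AskeyWilson.exists_characteristic_coeff_zero_le hp0 hp1 ha hf
      (fun h => hnc ⟨0, h⟩) hsol
    -- The power of `α` is at most one, so it suffices to bound the order of `a 0` itself.
    refine (mul_le_of_le_one_left h0.le (pow_le_one₀ hα0 hα1)).trans ?_
    exact AskeyWilson.phiOrder_le_of_characteristic_le hφ hsub hC hK hT h0
      fun j hj => hdom (j + 1) (by omega) (by omega)
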